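/- Let $\gamma=(\gamma_1,\gamma_2,\gamma_3)\in\mathbb C^3$ with $\operatorname{Im}\gamma_i<\tfrac12$ for $i=1,2,3$, and let $x=(x_1,x_2,x_3)\in\mathbb R^3$. Then the Givental integral for the $\mathfrak{gl}_3(\mathbb R)$-Whittaker function, $$ \Psi^{\mathrm{Giv}}_{\gamma}(x)=e^{\imath\gamma_3(x_1+x_2+x_3)}\int_{\mathbb R^3}dT_{11}\,dT_{21}\,dT_{22}\; e^{\imath(\gamma_2-\gamma_3)(T_{21}+T_{22})+\imath(\gamma_1-\gamma_2)T_{11}} $$ $$ \times\exp\Big\{-e^{x_1-T_{21}}-e^{T_{21}-x_2}-e^{x_2-T_{22}}-e^{T_{22}-x_3}-e^{T_{21}-T_{11}}-e^{T_{11}-T_{22}}\Big\}, $$ and the Mellin–Barnes integral, $$ \Psi^{\mathrm{MB}}_{\gamma}(x)=\frac{e^{\imath(\gamma_1+\gamma_2+\gamma_3)x_3-(x_1-x_3)}}{2!\,(2\pi)^3} \int_{\mathbb R^3}\frac{d\tau_{11}\,d\tau_{21}\,d\tau_{22}}{\Gamma(\imath\tau_{21}-\imath\tau_{22})\,\Gamma(\imath\tau_{22}-\imath\tau_{21})}\;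 e^{\imath(x_2-x_3)(\tau_{21}+\tau_{22})+\imath(x_1-x_2)\tau_{11}} $$ $$ \times\;\Gamma\Big(\imath(\tau_{21}-\tau_{11})+\tfrac12\Big)\,\Gamma\Big(\imath(\tau_{22}-\tau_{11})+\tfrac12\Big) \prod_{i=1}^3\prod_{j=1}^2\Gamma\Big(\imath(\gamma_i-\tau_{2j})+\tfrac12\Big), $$ both converge absolutely and coincide: $\Psi^{\mathrm{Giv}}_{\gamma}(x)=\Psi^{\mathrm{MB}}_{\gamma}(x)$. (The function $1/\Gamma$ is understood as an entire function, so the Mellin–Barnes integrand vanishes where $\tau_{21}=\tau_{22}$.) -/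

import Mathlib

noncomputable section

/-- The integrand of the Givental integral for the `gl₃(ℝ)`-Whittaker function, without the factor
in front of the integral. The spectral parameters are `γ₁, γ₂, γ₃ = γ 0, γ 1, γ 2`, the
coordinates are `x₁, x₂, x₃ = x 0, x 1, x 2`, and the integration variable is
`T = (T₁₁, T₂₁, T₂₂)`. -/
def giventalIntegrand (γ : Fin 3 → ℂ) (x : Fin 3 → ℝ) : ℝ × ℝ × ℝ → ℂ :=
  fun (T₁₁, T₂₁, T₂₂) =>
    Complex.exp (Complex.I * (γ 1 - γ 2) * ((T₂₁ : ℂ) + (T₂₂ : ℂ))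
        + Complex.I * (γ 0 - γ 1) * (T₁₁ : ℂ))
      * (Real.exp (-Real.exp (x 0 - T₂₁) - Real.exp (T₂₁ - x 1)
          - Real.exp (x 1 - T₂₂) - Real.exp (T₂₂ - x 2)
          - Real.exp (T₂₁ - T₁₁) - Real.exp (T₁₁ - T₂₂)) : ℂ)

/-- The Givental integral over `ℝ³` for the `gl₃(ℝ)`-Whittaker function. -/
def giventalIntegral (γ : Fin 3 → ℂ) (x : Fin 3 → ℝ) : ℂ :=
  Complex.exp (Complex.I * γ 2 * ((x 0 : ℂ) + (x 1 : ℂ) + (x 2 : ℂ)))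
    * ∫ T : ℝ × ℝ × ℝ, giventalIntegrand γ x T

/-- The integrand of the Mellin–Barnes integral for the `gl₃(ℝ)`-Whittaker function, without the
factor in front of the integral. The integration variable is `τ = (τ₁₁, τ₂₁, τ₂₂)`. Where
`τ₂₁ = τ₂₂`, both Gamma functions in the denominator have a pole, and the integrand is `0`:
this is the value that the convention `1 / 0 = 0` gives, since `Complex.Gamma 0 = 0`. -/
def mellinBarnesIntegrand (γ : Fin 3 → ℂ) (x : Fin 3 → ℝ) : ℝ × ℝ × ℝ → ℂ :=
  fun (τ₁₁, τ₂₁, τ₂₂) =>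
    1 / (Complex.Gamma (Complex.I * τ₂₁ - Complex.I * τ₂₂)
          * Complex.Gamma (Complex.I * τ₂₂ - Complex.I * τ₂₁))
      * Complex.exp (Complex.I * ((x 1 : ℂ) - (x 2 : ℂ)) * ((τ₂₁ : ℂ) + (τ₂₂ : ℂ))
          + Complex.I * ((x 0 : ℂ) - (x 1 : ℂ)) * (τ₁₁ : ℂ))
      * Complex.Gamma (Complex.I * ((τ₂₁ : ℂ) - (τ₁₁ : ℂ)) + 1 / 2)
      * Complex.Gamma (Complex.I * ((τ₂₂ : ℂ) - (τ₁₁ : ℂ)) + 1 / 2)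
      * ∏ i : Fin 3, (Complex.Gamma (Complex.I * (γ i - (τ₂₁ : ℂ)) + 1 / 2)
          * Complex.Gamma (Complex.I * (γ i - (τ₂₂ : ℂ)) + 1 / 2))

/-- The Mellin–Barnes integral over `ℝ³` for the `gl₃(ℝ)`-Whittaker function, with
`ρ(x) = x₁ - x₃`. The factor `2` next to `(2π)³` is the order `2!` of the symmetric group
that permutes `τ₂₁` and `τ₂₂`. -/
def mellinBarnesIntegral (γ : Fin 3 → ℂ) (x : Fin 3 → ℝ) : ℂ :=
  Complex.exp (Complex.I * (γ 0 + γ 1 + γ 2) * (x 2 : ℂ) - ((x 0 : ℂ) - (x 2 : ℂ)))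
      / (2 * (2 * (Real.pi : ℂ)) ^ 3)
    * ∫ τ : ℝ × ℝ × ℝ, mellinBarnesIntegrand γ x τ

end

open MeasureTheory Set Filter Topology

/-! Both sides are reduced to one double integral over `w` of an explicit quotient of Gamma
functions, `barnesKernel`.

Givental side: the factors of the integrand containing `x 0` and `x 2` are exponentials of the form
`exp (-exp y)`, and each is written as a Mellin–Barnes integral (`integral_Gamma_mul_exp`). This
gives an absolutely integrable function of five real variables, `mixedIntegrand`. For fixed `w`,
what remains in `T` splits, once `T₁₁` is frozen, into two Gamma integrals; the last integration is
a Beta integral (`integral_coreIntegrand`). Fubini then gives `(2π)² ∫ giventalIntegrand = ∫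
barnesKernel`.

Mellin–Barnes side: put `τ₂₁ = σ/2 + t` and `τ₂₂ = σ/2 - t`. For fixed `τ₁₁` and `σ`, the integral
over `t` is a de Branges–Wilson integral with parameters `1/2 + i(σ/2 - τ₁₁)` and `1/2 + i(γ i -
σ/2)`; its value is `4π` times the same Gamma quotient at `w = (τ₁₁, σ)`.

The de Branges–Wilson formula (`wilsonIntegral_eq`) is itself proved here. A contour shift relates
the integral at `a + 1` to that at `a`; iterating it and comparing asymptotics shows that the
quotient of the two sides is independent of `a`, hence by symmetry of all parameters. The limit `a →
0` at `b = c = d = 1/2` is elementary and gives the constant.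

The condition on `γ` keeps the arguments of all the numerator Gamma functions in the right
half-plane along the real contours. -/

theorem integrable_exp_neg_mul_abs {c : ℝ} (hc : 0 < c) :
    Integrable fun x : ℝ => Real.exp (-(c * |x|)) := by
  rw [← integrableOn_univ, ← Iic_union_Ioi (a := (0 : ℝ))]
  refine IntegrableOn.union ?_ ?_
  · refine (integrableOn_exp_mul_Iic hc 0).congr_fun (fun x hx => ?_) measurableSet_Iic
    simp [abs_of_nonpos (mem_Iic.1 hx)]
  · refine (integrableOn_exp_mul_Ioi (neg_neg_of_pos hc) 0).congr_fun (fun x hx => ?_)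
      measurableSet_Ioi
    simp [abs_of_pos (mem_Ioi.1 hx)]

/-! ### The Gamma integral in logarithmic coordinates -/

theorem exp_image_univ : Real.exp '' univ = Ioi 0 := by
  rw [image_univ, Real.range_exp]

theorem integral_Ioi_eq_integral_exp_smul (f : ℝ → ℂ) :
    ∫ x in Ioi (0 : ℝ), f x = ∫ T : ℝ, Real.exp T • f (Real.exp T) := by
  rw [← exp_image_univ, integral_image_eq_integral_abs_deriv_smul MeasurableSet.univ
    (fun x _ => (Real.hasDerivAt_exp x).hasDerivWithinAt) Real.exp_injective.injOn]
  simp [abs_of_pos (Real.exp_pos _)]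

theorem integrableOn_Ioi_iff_integrable_exp_smul (f : ℝ → ℂ) :
    IntegrableOn f (Ioi (0 : ℝ)) ↔ Integrable fun T : ℝ => Real.exp T • f (Real.exp T) := by
  rw [← exp_image_univ, integrableOn_image_iff_integrableOn_abs_deriv_smul MeasurableSet.univ
    (fun x _ => (Real.hasDerivAt_exp x).hasDerivWithinAt) Real.exp_injective.injOn,
    integrableOn_univ]
  simp [abs_of_pos (Real.exp_pos _)]

theorem ofReal_exp_cpow (T : ℝ) (z : ℂ) : ((Real.exp T : ℝ) : ℂ) ^ z = Complex.exp (z * T) := by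
  rw [Complex.cpow_def_of_ne_zero (by simp), ← Complex.ofReal_log (Real.exp_pos T).le,
    Real.log_exp, mul_comm]

theorem exp_smul_gamma_integrand (z : ℂ) (m T : ℝ) :
    Real.exp T • (((Real.exp T : ℝ) : ℂ) ^ (z - 1) * Complex.exp (-(m * (Real.exp T : ℝ))))
      = Complex.exp (z * T - m * (Real.exp T : ℝ)) := by
  rw [ofReal_exp_cpow, Complex.real_smul, Complex.ofReal_exp, ← Complex.exp_add,
    ← Complex.exp_add]
  ring_nf

/-- The Gamma integral in logarithmic coordinates. -/
theorem integral_exp_mul_sub_mul_exp {z : ℂ} (hz : 0 < z.re) {m : ℝ} (hm : 0 < m) :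
    ∫ T : ℝ, Complex.exp (z * T - m * (Real.exp T : ℝ))
      = Complex.exp (-z * Real.log m) * Complex.Gamma z := by
  have h := Complex.integral_cpow_mul_exp_neg_mul_Ioi hz hm
  rw [integral_Ioi_eq_integral_exp_smul] at h
  simp_rw [exp_smul_gamma_integrand] at h
  rw [h]
  congr 1
  have : (1 / (m : ℂ)) = ((Real.exp (-Real.log m) : ℝ) : ℂ) := by
    rw [Real.exp_neg, Real.exp_log hm]; push_cast; simp
  rw [this, ofReal_exp_cpow]
  push_cast
  ring_nf

theorem integrable_exp_mul_sub_exp {z : ℂ} (hz : 0 < z.re) :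
    Integrable fun T : ℝ => Complex.exp (z * T - (Real.exp T : ℝ)) := by
  have h := Complex.GammaIntegral_convergent hz
  rw [integrableOn_Ioi_iff_integrable_exp_smul] at h
  convert h using 2 with T
  have := exp_smul_gamma_integrand z 1 T
  simp only [Complex.ofReal_one, one_mul] at this
  rw [← this]
  congr 1
  push_cast
  ring

theorem integrable_exp_mul_sub_mul_exp {z : ℂ} (hz : 0 < z.re) {m : ℝ} (hm : 0 < m) :
    Integrable fun T : ℝ => Complex.exp (z * T - m * (Real.exp T : ℝ)) := by
  have h := ((integrable_exp_mul_sub_exp hz).comp_add_right (Real.log m)).const_mul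
    (Complex.exp (-z * Real.log m))
  convert h using 2 with T
  rw [← Complex.exp_add, Real.exp_add, Real.exp_log hm]
  push_cast
  ring_nf

/-! ### Contour shifts and exponential decay of Γ on vertical lines -/

/-- Shifting a horizontal contour inside a strip, under an integrable bound that vanishes at
infinity. -/
theorem integral_horizontal_eq_of_differentiableOn {f : ℂ → ℂ} {a b : ℝ} {g : ℝ → ℝ}
    (hd : DifferentiableOn ℂ f {u | u.im ∈ uIcc a b})
    (hb : ∀ t : ℝ, ∀ y ∈ uIcc a b, ‖f (t + y * Complex.I)‖ ≤ g t)
    (hg : Integrable g) (htop : Tendsto g atTop (𝓝 0)) (hbot : Tendsto g atBot (𝓝 0)) :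
    ∫ t : ℝ, f (t + a * Complex.I) = ∫ t : ℝ, f (t + b * Complex.I) := by
  have hcont : ∀ y ∈ uIcc a b, Continuous fun t : ℝ => f (t + y * Complex.I) := by
    intro y hy
    refine hd.continuousOn.comp_continuous (by fun_prop) (fun t => ?_)
    simpa using hy
  have hint : ∀ y ∈ uIcc a b, Integrable fun t : ℝ => f (t + y * Complex.I) := fun y hy =>
    hg.mono' (hcont y hy).aestronglyMeasurable (Eventually.of_forall fun t => hb t y hy)
  have hrect : ∀ R : ℝ, (∫ x in (-R)..R, f (x + a * Complex.I))
      - (∫ x in (-R)..R, f (x + b * Complex.I))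
      = Complex.I • (∫ y in a..b, f ((-R : ℝ) + y * Complex.I))
        - Complex.I • (∫ y in a..b, f (R + y * Complex.I)) := by
    intro R
    have h := Complex.integral_boundary_rect_eq_zero_of_differentiableOn f
      (⟨-R, a⟩ : ℂ) (⟨R, b⟩ : ℂ) (hd.mono fun u hu => hu.2)
    simp only [] at h
    linear_combination h
  have hside : ∀ {l : Filter ℝ}, Tendsto g l (𝓝 0) →
      Tendsto (fun R : ℝ => Complex.I • ∫ y in a..b, f (R + y * Complex.I)) l (𝓝 0) := by
    intro l hl
    rw [tendsto_zero_iff_norm_tendsto_zero]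
    refine squeeze_zero (fun _ => norm_nonneg _) (fun R => ?_)
      (by simpa using hl.mul_const |b - a|)
    rw [norm_smul, Complex.norm_I, one_mul]
    exact intervalIntegral.norm_integral_le_of_norm_le_const
      fun y hy => hb R y (uIoc_subset_uIcc hy)
  have hL : Tendsto (fun R : ℝ => (∫ x in (-R)..R, f (x + a * Complex.I))
      - (∫ x in (-R)..R, f (x + b * Complex.I))) atTop
      (𝓝 ((∫ t : ℝ, f (t + a * Complex.I)) - ∫ t : ℝ, f (t + b * Complex.I))) :=
    (intervalIntegral_tendsto_integral (hint a left_mem_uIcc) tendsto_neg_atTop_atBot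
      tendsto_id).sub (intervalIntegral_tendsto_integral (hint b right_mem_uIcc)
      tendsto_neg_atTop_atBot tendsto_id)
  have hR := ((hside hbot).comp tendsto_neg_atTop_atBot).sub (hside htop)
  simp only [sub_zero] at hR
  refine sub_eq_zero.1 (tendsto_nhds_unique hL (hR.congr fun R => ?_))
  simp only [Function.comp]
  rw [hrect R]

theorem tendsto_exp_mul_sub_mul_exp_atTop (s : ℝ) {c : ℝ} (hc : 0 < c) :
    Tendsto (fun T : ℝ => Real.exp (s * T - c * Real.exp T)) atTop (𝓝 0) := by
  refine ((tendsto_rpow_mul_exp_neg_mul_atTop_nhds_zero s c hc).comp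
    Real.tendsto_exp_atTop).congr fun T => ?_
  simp only [Function.comp]
  rw [← Real.exp_mul, ← Real.exp_add]
  ring_nf

theorem tendsto_exp_mul_sub_mul_exp_atBot {s : ℝ} (hs : 0 < s) {c : ℝ} (hc : 0 < c) :
    Tendsto (fun T : ℝ => Real.exp (s * T - c * Real.exp T)) atBot (𝓝 0) := by
  refine squeeze_zero (fun _ => (Real.exp_pos _).le) (g := fun T => Real.exp (s * T))
    (fun T => Real.exp_le_exp.2 ?_)
    (Real.tendsto_exp_atBot.comp (tendsto_id.const_mul_atBot hs))
  have := Real.exp_pos T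
  nlinarith

theorem norm_exp_mul_sub_exp (s : ℂ) (T y : ℝ) :
    ‖Complex.exp (s * (T + y * Complex.I) - Complex.exp (T + y * Complex.I))‖
      = Real.exp (-(s.im * y)) * Real.exp (s.re * T - Real.cos y * Real.exp T) := by
  rw [Complex.norm_exp, ← Real.exp_add]
  congr 1
  simp [Complex.exp_re]
  ring

/-- Rotating the contour of the Gamma integral by the angle `φ` bounds the Gamma function on
vertical lines. -/
theorem norm_Gamma_le_of_angle {s : ℂ} (hs : 0 < s.re) {φ : ℝ} (hφ : |φ| < Real.pi / 2) :
    ‖Complex.Gamma s‖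
      ≤ Real.exp (-(φ * s.im)) * (Real.exp (-(s.re * Real.log (Real.cos φ))) * Real.Gamma s.re) := by
  have hc : 0 < Real.cos φ := Real.cos_pos_of_mem_Ioo (abs_lt.1 hφ)
  have hre : Integrable fun T : ℝ => Real.exp (s.re * T - Real.cos φ * Real.exp T) := by
    have := (integrable_exp_mul_sub_mul_exp (z := (s.re : ℂ)) (by simpa using hs) hc).norm
    refine this.congr (Eventually.of_forall fun T => ?_)
    simp only [Complex.norm_exp]
    congr 1
    simp [Complex.cos_ofReal_re, Complex.exp_ofReal_re]
  have hre' : ∫ T : ℝ, Real.exp (s.re * T - Real.cos φ * Real.exp T)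
      = Real.exp (-(s.re * Real.log (Real.cos φ))) * Real.Gamma s.re := by
    have := integral_exp_mul_sub_mul_exp (z := (s.re : ℂ)) (by simpa using hs) hc
    apply Complex.ofReal_injective
    rw [← integral_complex_ofReal]
    push_cast
    push_cast at this
    rw [this, Complex.Gamma_ofReal]
    ring_nf
  -- In logarithmic coordinates the rotation is a vertical translation. Between the two lines the
  -- damping factor is at least `cos φ`, which is positive because `|φ| < π/2`.
  have key : ∫ T : ℝ, Complex.exp (s * (T + (0 : ℝ) * Complex.I) - Complex.exp (T + (0 : ℝ) * Complex.I))
      = ∫ T : ℝ, Complex.exp (s * (T + φ * Complex.I) - Complex.exp (T + φ * Complex.I)) := by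
    refine integral_horizontal_eq_of_differentiableOn
      (f := fun u => Complex.exp (s * u - Complex.exp u))
      (g := fun T => Real.exp (|s.im| * |φ|) * Real.exp (s.re * T - Real.cos φ * Real.exp T))
      (by fun_prop) ?_ (hre.const_mul _) ?_ ?_
    · intro T y hy
      have hy' : |y| ≤ |φ| := by
        rcases le_total 0 φ with h | h
        · rw [uIcc_of_le h] at hy; rw [abs_of_nonneg hy.1, abs_of_nonneg h]; exact hy.2
        · rw [uIcc_of_ge h] at hy; rw [abs_of_nonpos hy.2, abs_of_nonpos h]; linarith [hy.1]
      rw [norm_exp_mul_sub_exp]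
      have h1 : Real.cos φ ≤ Real.cos y := by
        rw [← Real.cos_abs φ, ← Real.cos_abs y]
        exact Real.cos_le_cos_of_nonneg_of_le_pi (abs_nonneg _) (by linarith [Real.pi_pos]) hy'
      gcongr
      calc -(s.im * y) ≤ |s.im * y| := neg_le_abs _
        _ = |s.im| * |y| := abs_mul _ _
        _ ≤ _ := by gcongr
    · simpa using (tendsto_exp_mul_sub_mul_exp_atTop s.re hc).const_mul _
    · simpa using (tendsto_exp_mul_sub_mul_exp_atBot hs hc).const_mul _
  have h0 := integral_exp_mul_sub_mul_exp hs one_pos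
  simp only [Complex.ofReal_one, one_mul, Real.log_one, Complex.ofReal_zero, mul_zero,
    Complex.exp_zero] at h0
  have : Complex.Gamma s
      = ∫ T : ℝ, Complex.exp (s * (T + φ * Complex.I) - Complex.exp (T + φ * Complex.I)) := by
    rw [← key, ← h0]
    simp
  rw [this]
  refine (norm_integral_le_integral_norm _).trans (le_of_eq ?_)
  simp_rw [norm_exp_mul_sub_exp]
  rw [integral_const_mul, hre', mul_comm s.im]

/-- The constant in the bound of `Γ` on the vertical line of abscissa `σ`. -/
noncomputable def gammaBound (σ : ℝ) : ℝ :=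
  Real.exp (-(σ * Real.log (Real.cos (3 / 2)))) * Real.Gamma σ

/-- The angle `3/2` is close enough to `π/2` for all later estimates: three pairs `Γ(b ± it)` decay
like `e^{-9|t|}`, which beats the bound `8 e^{8|t|}` on `wilsonDensity`. -/
theorem three_half_lt_pi_half : (3 / 2 : ℝ) < Real.pi / 2 := by
  linarith [Real.pi_gt_three]

theorem gammaBound_nonneg {σ : ℝ} (hσ : 0 < σ) : 0 ≤ gammaBound σ :=
  mul_nonneg (Real.exp_pos _).le (Real.Gamma_pos_of_pos hσ).le

theorem continuousOn_gammaBound : ContinuousOn gammaBound (Ioi 0) := by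
  unfold gammaBound
  refine ContinuousOn.mul (by fun_prop) ?_
  intro x hx
  refine (Real.differentiableAt_Gamma fun m => ?_).continuousAt.continuousWithinAt
  have h1 : (0 : ℝ) < x := hx
  have h2 : (0 : ℝ) ≤ m := m.cast_nonneg
  linarith

/-- The contour is rotated by `3/2` in the direction given by the sign of `s.im`. -/
theorem norm_Gamma_le {s : ℂ} (hs : 0 < s.re) :
    ‖Complex.Gamma s‖ ≤ gammaBound s.re * Real.exp (-(3 / 2 * |s.im|)) := by
  have h32 : |(3 / 2 : ℝ)| < Real.pi / 2 := by
    rw [abs_of_pos (by norm_num)]; exact three_half_lt_pi_half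
  rcases le_total 0 s.im with h | h
  · have := norm_Gamma_le_of_angle hs h32
    rwa [mul_comm, ← abs_of_nonneg h] at this
  · have := norm_Gamma_le_of_angle hs (φ := -(3 / 2)) (by rwa [abs_neg])
    rw [Real.cos_neg, mul_comm, neg_mul_comm, ← abs_of_nonpos h] at this
    exact this

theorem norm_Gamma_le_Gamma_re {s : ℂ} (hs : 0 < s.re) :
    ‖Complex.Gamma s‖ ≤ Real.Gamma s.re := by
  simpa using norm_Gamma_le_of_angle hs (φ := 0) (by simpa using Real.pi_pos)

/-! ### The de Branges–Wilson integrand and its bounds -/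

/-- The product `Γ(a + it) Γ(a - it)`. -/
noncomputable def gammaPair (a : ℂ) (t : ℝ) : ℂ :=
  Complex.Gamma (a + Complex.I * t) * Complex.Gamma (a - Complex.I * t)

/-- The density `1 / (Γ(z) Γ(-z))` at `z = 2 * i * t`, in closed form. -/
noncomputable def wilsonDensity (t : ℝ) : ℝ := 2 * t * Real.sinh (2 * Real.pi * t) / Real.pi

/-- The de Branges–Wilson integral. -/
noncomputable def wilsonIntegral (a b c d : ℂ) : ℂ :=
  ∫ t : ℝ, (wilsonDensity t : ℂ)
    * (gammaPair a t * gammaPair b t * gammaPair c t * gammaPair d t)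

/-- The de Branges–Wilson integral with three parameters. -/
noncomputable def wilsonIntegral₃ (b c d : ℂ) : ℂ :=
  ∫ t : ℝ, (wilsonDensity t : ℂ) * (gammaPair b t * gammaPair c t * gammaPair d t)

theorem add_I_mul_re (a : ℂ) (t : ℝ) : (a + Complex.I * t).re = a.re := by simp
theorem sub_I_mul_re (a : ℂ) (t : ℝ) : (a - Complex.I * t).re = a.re := by simp
theorem sub_I_mul_im (a : ℂ) (t : ℝ) : (a - Complex.I * t).im = a.im - t := by simp

theorem two_mul_abs_le (x t : ℝ) : 2 * |t| ≤ |x + t| + |x - t| := by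
  have h1 := abs_sub (x + t) (x - t)
  rw [show x + t - (x - t) = 2 * t by ring, abs_mul, abs_two] at h1
  exact h1

theorem ne_zero_of_re_pos {z : ℂ} (hz : 0 < z.re) : z ≠ 0 := by
  rintro rfl
  simp at hz

/-- Since `|x + t| + |x - t| ≥ 2|t|`, the common part `x` of the imaginary parts does not spoil the
decay in `t`. -/
theorem norm_Gamma_mul_Gamma_le {z w : ℂ} {t x : ℝ} (hz : 0 < z.re) (hw : 0 < w.re)
    (hzi : z.im = x + t) (hwi : w.im = x - t) :
    ‖Complex.Gamma z * Complex.Gamma w‖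
      ≤ gammaBound z.re * gammaBound w.re * Real.exp (-(3 * |t|)) := by
  rw [norm_mul]
  refine (mul_le_mul (norm_Gamma_le hz) (norm_Gamma_le hw) (norm_nonneg _)
    (mul_nonneg (gammaBound_nonneg hz) (Real.exp_pos _).le)).trans ?_
  rw [mul_mul_mul_comm, ← Real.exp_add]
  refine mul_le_mul_of_nonneg_left (Real.exp_le_exp.2 ?_)
    (mul_nonneg (gammaBound_nonneg hz) (gammaBound_nonneg hw))
  rw [hzi, hwi]
  have := two_mul_abs_le x t
  linarith

theorem norm_gammaPair_le {a : ℂ} (ha : 0 < a.re) (t : ℝ) :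
    ‖gammaPair a t‖ ≤ gammaBound a.re ^ 2 * Real.exp (-(3 * |t|)) := by
  have := norm_Gamma_mul_Gamma_le (z := a + Complex.I * t) (w := a - Complex.I * t)
    (t := t) (x := a.im) (by simpa using ha) (by simpa using ha) (by simp) (by simp)
  rw [add_I_mul_re, sub_I_mul_re, ← sq] at this
  exact this

theorem continuous_Gamma_comp {X : Type*} [TopologicalSpace X] {f : X → ℂ} (hf : Continuous f)
    (h : ∀ t, 0 < (f t).re) :
    Continuous fun t => Complex.Gamma (f t) := by
  refine continuous_iff_continuousAt.2 fun t => ?_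
  refine ContinuousAt.comp (Complex.differentiableAt_Gamma _ fun m hm => ?_).continuousAt
    hf.continuousAt
  have h1 := h t
  rw [hm] at h1
  have h2 : (0 : ℝ) ≤ m := m.cast_nonneg
  simp at h1
  linarith

theorem continuous_gammaPair {a : ℂ} (ha : 0 < a.re) : Continuous (gammaPair a) :=
  (continuous_Gamma_comp (by fun_prop) fun t => by simpa using ha).mul
    (continuous_Gamma_comp (by fun_prop) fun t => by simpa using ha)

theorem gammaPair_add_one {a : ℂ} (ha : 0 < a.re) (t : ℝ) :
    gammaPair (a + 1) t = (a ^ 2 + (t : ℂ) ^ 2) * gammaPair a t := by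
  have h1 : a + Complex.I * t ≠ 0 := ne_zero_of_re_pos (by simpa using ha)
  have h2 : a - Complex.I * t ≠ 0 := ne_zero_of_re_pos (by simpa using ha)
  unfold gammaPair
  rw [show a + 1 + Complex.I * t = (a + Complex.I * t) + 1 by ring,
    show a + 1 - Complex.I * t = (a - Complex.I * t) + 1 by ring,
    Complex.Gamma_add_one _ h1, Complex.Gamma_add_one _ h2]
  linear_combination (-(t:ℂ)^2 * Complex.Gamma (a + Complex.I * t)
    * Complex.Gamma (a - Complex.I * t)) * Complex.I_sq

theorem abs_sinh_le (x : ℝ) : |Real.sinh x| ≤ |x| * Real.exp |x| := by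
  rw [Real.abs_sinh, Real.sinh_eq]
  have h1 := Real.add_one_le_exp (-(2 * |x|))
  have h2 : Real.exp (-|x|) = Real.exp |x| * Real.exp (-(2 * |x|)) := by
    rw [← Real.exp_add]; ring_nf
  rw [h2]
  nlinarith [Real.exp_pos |x|]

theorem continuous_wilsonDensity : Continuous wilsonDensity := by
  unfold wilsonDensity
  fun_prop

theorem sq_le_two_mul_exp_abs (t : ℝ) : t ^ 2 ≤ 2 * Real.exp |t| := by
  have := Real.quadratic_le_exp_of_nonneg (abs_nonneg t)
  rw [sq_abs] at this
  linarith [abs_nonneg t]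

/-- The factor `t ^ 2` is kept because it later absorbs the singularity of `gammaPair a t` at `t =
0` as `a → 0`. The rate `7` is an upper bound for `2π`. -/
theorem abs_wilsonDensity_le_sq (t : ℝ) :
    |wilsonDensity t| ≤ t ^ 2 * (4 * Real.exp (7 * |t|)) := by
  have hpi := Real.pi_pos
  have h := abs_sinh_le (2 * Real.pi * t)
  have e : |2 * Real.pi * t| = 2 * Real.pi * |t| := by
    rw [abs_mul, abs_of_pos (by positivity)]
  rw [e] at h
  have h2 : Real.exp (2 * Real.pi * |t|) ≤ Real.exp (7 * |t|) := by
    refine Real.exp_le_exp.2 (mul_le_mul_of_nonneg_right ?_ (abs_nonneg t))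
    linarith [Real.pi_lt_d2]
  unfold wilsonDensity
  rw [abs_div, abs_mul, abs_mul, abs_two, abs_of_pos hpi, div_le_iff₀ hpi]
  calc 2 * |t| * |Real.sinh (2 * Real.pi * t)|
      ≤ 2 * |t| * (2 * Real.pi * |t| * Real.exp (7 * |t|)) := by gcongr; exact h.trans (by gcongr)
    _ = |t| ^ 2 * (4 * Real.exp (7 * |t|)) * Real.pi := by ring
    _ = _ := by rw [sq_abs]

theorem abs_wilsonDensity_le (t : ℝ) : |wilsonDensity t| ≤ 8 * Real.exp (8 * |t|) := by
  refine (abs_wilsonDensity_le_sq t).trans ?_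
  have := sq_le_two_mul_exp_abs t
  calc t ^ 2 * (4 * Real.exp (7 * |t|)) ≤ 2 * Real.exp |t| * (4 * Real.exp (7 * |t|)) := by gcongr
    _ = 8 * (Real.exp |t| * Real.exp (7 * |t|)) := by ring
    _ = _ := by rw [← Real.exp_add]; ring_nf

theorem norm_mul_le_of_le_mul_exp {x y : ℂ} {A B α β r : ℝ} (hx : ‖x‖ ≤ A * Real.exp (α * r))
    (hy : ‖y‖ ≤ B * Real.exp (β * r)) : ‖x * y‖ ≤ A * B * Real.exp ((α + β) * r) := by
  rw [norm_mul, add_mul, Real.exp_add, mul_mul_mul_comm]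
  exact mul_le_mul hx hy (norm_nonneg _) ((norm_nonneg _).trans hx)

theorem integrable_of_norm_le_mul_exp {f : ℝ → ℂ} (hf : Continuous f) {A α : ℝ} (hα : α < 0)
    (h : ∀ t, ‖f t‖ ≤ A * Real.exp (α * |t|)) : Integrable f := by
  refine ((integrable_exp_neg_mul_abs (neg_pos.2 hα)).const_mul A).mono'
    hf.aestronglyMeasurable (Eventually.of_forall fun t => (h t).trans (le_of_eq ?_))
  ring_nf

theorem norm_gammaPair_le' {a : ℂ} (ha : 0 < a.re) (t : ℝ) :
    ‖gammaPair a t‖ ≤ gammaBound a.re ^ 2 * Real.exp (-3 * |t|) := by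
  simpa [neg_mul] using norm_gammaPair_le ha t

theorem norm_gammaPair₃_le {b c d : ℂ} (hb : 0 < b.re) (hc : 0 < c.re) (hd : 0 < d.re) (t : ℝ) :
    ‖gammaPair b t * gammaPair c t * gammaPair d t‖
      ≤ gammaBound b.re ^ 2 * gammaBound c.re ^ 2 * gammaBound d.re ^ 2
        * Real.exp (-9 * |t|) := by
  convert norm_mul_le_of_le_mul_exp (norm_mul_le_of_le_mul_exp (norm_gammaPair_le' hb t)
    (norm_gammaPair_le' hc t)) (norm_gammaPair_le' hd t) using 3
  norm_num

theorem norm_gammaPair₄_le {a b c d : ℂ} (ha : 0 < a.re) (hb : 0 < b.re) (hc : 0 < c.re)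
    (hd : 0 < d.re) (t : ℝ) :
    ‖gammaPair a t * gammaPair b t * gammaPair c t * gammaPair d t‖
      ≤ gammaBound a.re ^ 2 * gammaBound b.re ^ 2 * gammaBound c.re ^ 2 * gammaBound d.re ^ 2
        * Real.exp (-12 * |t|) := by
  convert norm_mul_le_of_le_mul_exp (norm_gammaPair₃_le ha hb hc t)
    (norm_gammaPair_le' hd t) using 3
  norm_num

theorem norm_wilsonDensity_le (t : ℝ) : ‖(wilsonDensity t : ℂ)‖ ≤ 8 * Real.exp (8 * |t|) := by
  rw [Complex.norm_real]
  exact abs_wilsonDensity_le t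

theorem norm_wilson₃_le {b c d : ℂ} (hb : 0 < b.re) (hc : 0 < c.re) (hd : 0 < d.re) (t : ℝ) :
    ‖(wilsonDensity t : ℂ) * (gammaPair b t * gammaPair c t * gammaPair d t)‖
      ≤ 8 * (gammaBound b.re ^ 2 * gammaBound c.re ^ 2 * gammaBound d.re ^ 2)
        * Real.exp (-1 * |t|) := by
  convert norm_mul_le_of_le_mul_exp (norm_wilsonDensity_le t) (norm_gammaPair₃_le hb hc hd t)
    using 3
  norm_num

theorem continuous_gammaPair₄ {a b c d : ℂ} (ha : 0 < a.re) (hb : 0 < b.re) (hc : 0 < c.re)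
    (hd : 0 < d.re) :
    Continuous fun t => gammaPair a t * gammaPair b t * gammaPair c t * gammaPair d t :=
  (((continuous_gammaPair ha).mul (continuous_gammaPair hb)).mul
    (continuous_gammaPair hc)).mul (continuous_gammaPair hd)

theorem continuous_wilson {a b c d : ℂ} (ha : 0 < a.re) (hb : 0 < b.re) (hc : 0 < c.re)
    (hd : 0 < d.re) :
    Continuous fun t => (wilsonDensity t : ℂ)
      * (gammaPair a t * gammaPair b t * gammaPair c t * gammaPair d t) :=
  (Complex.continuous_ofReal.comp continuous_wilsonDensity).mul
    (continuous_gammaPair₄ ha hb hc hd)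

theorem integrable_wilson {a b c d : ℂ} (ha : 0 < a.re) (hb : 0 < b.re) (hc : 0 < c.re)
    (hd : 0 < d.re) :
    Integrable fun t => (wilsonDensity t : ℂ)
      * (gammaPair a t * gammaPair b t * gammaPair c t * gammaPair d t) := by
  refine integrable_of_norm_le_mul_exp (continuous_wilson ha hb hc hd) (α := 8 + -12)
    (by norm_num) fun t => norm_mul_le_of_le_mul_exp (norm_wilsonDensity_le t)
      (norm_gammaPair₄_le ha hb hc hd t)

theorem exists_gammaBound_le {x : ℝ} (hx : 0 < x) :
    ∃ M, ∀ σ ∈ Icc x (x + 1), gammaBound σ ≤ M := by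
  obtain ⟨M, hM⟩ := isCompact_Icc.exists_bound_of_continuousOn
    (continuousOn_gammaBound.mono fun σ (hσ : σ ∈ Icc x (x + 1)) => hx.trans_le hσ.1)
  exact ⟨M, fun σ hσ => (le_abs_self _).trans (hM σ hσ)⟩

/-! ### The contiguity relation by a contour shift -/

/-- The pair of Gamma factors in the contour shift for the de Branges–Wilson integral. -/
noncomputable def shiftedPair (a u : ℂ) : ℂ :=
  Complex.Gamma (a + 1 / 2 + Complex.I * u) * Complex.Gamma (a + 1 / 2 - Complex.I * u)

theorem differentiableAt_Gamma_of_re_pos {z : ℂ} (hz : 0 < z.re) :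
    DifferentiableAt ℂ Complex.Gamma z := by
  refine Complex.differentiableAt_Gamma _ fun m hm => ?_
  rw [hm] at hz
  have h2 : (0 : ℝ) ≤ m := m.cast_nonneg
  simp at hz
  linarith

theorem differentiableAt_shiftedPair {a u : ℂ} (ha : 0 < a.re) (hu : |u.im| ≤ 1 / 2) :
    DifferentiableAt ℂ (shiftedPair a) u := by
  obtain ⟨h1, h2⟩ := abs_le.1 hu
  unfold shiftedPair
  refine DifferentiableAt.mul ?_ ?_
  · refine DifferentiableAt.comp u (differentiableAt_Gamma_of_re_pos ?_) (by fun_prop)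
    simp
    linarith
  · refine DifferentiableAt.comp u (differentiableAt_Gamma_of_re_pos ?_) (by fun_prop)
    simp
    linarith

theorem norm_shiftedPair_le {a : ℂ} {M : ℝ} (ha : 0 < a.re)
    (hM : ∀ σ ∈ Icc a.re (a.re + 1), gammaBound σ ≤ M) (t y : ℝ) (hy : |y| ≤ 1 / 2) :
    ‖shiftedPair a (t + y * Complex.I)‖ ≤ M ^ 2 * Real.exp (-3 * |t|) := by
  obtain ⟨h1, h2⟩ := abs_le.1 hy
  have e1 : (a + 1 / 2 + Complex.I * (t + y * Complex.I)).re = a.re + 1 / 2 - y := by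
    simp; ring
  have e2 : (a + 1 / 2 - Complex.I * (t + y * Complex.I)).re = a.re + 1 / 2 + y := by
    simp
  have f1 : (a + 1 / 2 + Complex.I * (t + y * Complex.I)).im = a.im + t := by simp
  have f2 : (a + 1 / 2 - Complex.I * (t + y * Complex.I)).im = a.im - t := by simp
  refine (norm_Gamma_mul_Gamma_le (by rw [e1]; linarith) (by rw [e2]; linarith) f1 f2).trans ?_
  rw [e1, e2, ← neg_mul, sq]
  have k1 := hM (a.re + 1 / 2 - y) ⟨by linarith, by linarith⟩
  have k2 := hM (a.re + 1 / 2 + y) ⟨by linarith, by linarith⟩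
  have n1 := gammaBound_nonneg (σ := a.re + 1 / 2 - y) (by linarith)
  have n2 := gammaBound_nonneg (σ := a.re + 1 / 2 + y) (by linarith)
  gcongr
  exact n1.trans k1

/-- On the lower edge of the strip the arguments are `a + 1 + it` and `a - it`, so the functional
equation produces one linear factor; the upper edge produces the conjugate-type factor from the
other argument. -/
theorem shiftedPair_sub_half {a : ℂ} (ha : 0 < a.re) (t : ℝ) :
    shiftedPair a (t + (-(1 / 2) : ℝ) * Complex.I) = (a + Complex.I * t) * gammaPair a t := by
  unfold shiftedPair gammaPair
  have h1 : a + Complex.I * t ≠ 0 := ne_zero_of_re_pos (by simpa using ha)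
  rw [show a + 1 / 2 + Complex.I * (t + (-(1 / 2) : ℝ) * Complex.I) = a + Complex.I * t + 1 by
      push_cast; linear_combination (-1 / 2 : ℂ) * Complex.I_sq,
    show a + 1 / 2 - Complex.I * (t + (-(1 / 2) : ℝ) * Complex.I) = a - Complex.I * t by
      push_cast; linear_combination (1 / 2 : ℂ) * Complex.I_sq, Complex.Gamma_add_one _ h1]
  ring

theorem shiftedPair_add_half {a : ℂ} (ha : 0 < a.re) (t : ℝ) :
    shiftedPair a (t + (1 / 2 : ℝ) * Complex.I) = (a - Complex.I * t) * gammaPair a t := by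
  unfold shiftedPair gammaPair
  have h1 : a - Complex.I * t ≠ 0 := ne_zero_of_re_pos (by simpa using ha)
  rw [show a + 1 / 2 + Complex.I * (t + (1 / 2 : ℝ) * Complex.I) = a + Complex.I * t by
      push_cast; linear_combination (1 / 2 : ℂ) * Complex.I_sq,
    show a + 1 / 2 - Complex.I * (t + (1 / 2 : ℝ) * Complex.I) = a - Complex.I * t + 1 by
      push_cast; linear_combination (-1 / 2 : ℂ) * Complex.I_sq, Complex.Gamma_add_one _ h1]
  ring

theorem norm_sinh_le (t y : ℝ) :
    ‖Complex.sinh (2 * Real.pi * (t + y * Complex.I))‖ ≤ 1 * Real.exp (7 * |t|) := by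
  have h1 : ∀ u : ℝ, |u| = |t| → Real.exp (2 * Real.pi * u) ≤ Real.exp (7 * |t|) := by
    intro u hu
    refine Real.exp_le_exp.2 ?_
    have h3 : u ≤ |t| := hu ▸ le_abs_self u
    have h4 : 0 ≤ |t| := abs_nonneg t
    nlinarith [Real.pi_lt_d2, Real.pi_pos]
  have e1 : ‖Complex.exp (2 * Real.pi * (t + y * Complex.I))‖ = Real.exp (2 * Real.pi * t) := by
    rw [Complex.norm_exp]; simp
  have e2 : ‖Complex.exp (-(2 * Real.pi * (t + y * Complex.I)))‖
      = Real.exp (2 * Real.pi * -t) := by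
    rw [Complex.norm_exp]; simp
  rw [Complex.sinh, norm_div, Complex.norm_two, one_mul, div_le_iff₀ two_pos]
  refine (norm_sub_le _ _).trans ?_
  rw [e1, e2]
  linarith [h1 t rfl, h1 (-t) (abs_neg t)]

/-- The contour shift for the de Branges–Wilson integrand. -/
theorem integral_sinh_mul_shift {a b c d : ℂ} (ha : 0 < a.re) (hb : 0 < b.re) (hc : 0 < c.re)
    (hd : 0 < d.re) :
    ∫ t : ℝ, Complex.sinh (2 * Real.pi * t) * ((a + Complex.I * t) * (b + Complex.I * t)
        * (c + Complex.I * t) * (d + Complex.I * t)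
        - (a - Complex.I * t) * (b - Complex.I * t) * (c - Complex.I * t) * (d - Complex.I * t))
        * (gammaPair a t * gammaPair b t * gammaPair c t * gammaPair d t) = 0 := by
  obtain ⟨A, hA⟩ := exists_gammaBound_le ha
  obtain ⟨B, hB⟩ := exists_gammaBound_le hb
  obtain ⟨C, hC⟩ := exists_gammaBound_le hc
  obtain ⟨D, hD⟩ := exists_gammaBound_le hd
  set f : ℂ → ℂ := fun u => Complex.sinh (2 * Real.pi * u)
    * (shiftedPair a u * shiftedPair b u * shiftedPair c u * shiftedPair d u) with hf
  set K : ℝ := 1 * (A ^ 2 * B ^ 2 * C ^ 2 * D ^ 2) with hK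
  have hstrip : ∀ y : ℝ, y ∈ uIcc (-(1 / 2) : ℝ) (1 / 2) → |y| ≤ 1 / 2 := by
    intro y hy
    rw [uIcc_of_le (by norm_num)] at hy
    exact abs_le.2 hy
  -- The rate is `7 - 4 * 3 = -5`: growth of sinh against four pairs.
  have hbound : ∀ t : ℝ, ∀ y ∈ uIcc (-(1 / 2) : ℝ) (1 / 2),
      ‖f (t + y * Complex.I)‖ ≤ K * Real.exp (-(5 * |t|)) := by
    intro t y hy
    have hy' := hstrip y hy
    have := norm_mul_le_of_le_mul_exp (norm_sinh_le t y)
      (norm_mul_le_of_le_mul_exp (norm_mul_le_of_le_mul_exp (norm_mul_le_of_le_mul_exp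
      (norm_shiftedPair_le ha hA t y hy') (norm_shiftedPair_le hb hB t y hy'))
      (norm_shiftedPair_le hc hC t y hy')) (norm_shiftedPair_le hd hD t y hy'))
    rw [← neg_mul]
    convert this using 3
    norm_num
  have hdiff : DifferentiableOn ℂ f {u | u.im ∈ uIcc (-(1 / 2) : ℝ) (1 / 2)} := by
    intro u hu
    have hu' := hstrip _ hu
    refine DifferentiableAt.differentiableWithinAt ?_
    refine DifferentiableAt.mul (by fun_prop) ?_
    exact (((differentiableAt_shiftedPair ha hu').mul (differentiableAt_shiftedPair hb hu')).mul
      (differentiableAt_shiftedPair hc hu')).mul (differentiableAt_shiftedPair hd hu')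
  have hlim : ∀ l : Filter ℝ, Tendsto (fun t : ℝ => |t|) l atTop →
      Tendsto (fun t : ℝ => K * Real.exp (-(5 * |t|))) l (𝓝 0) := by
    intro l hl
    simpa using (Real.tendsto_exp_neg_atTop_nhds_zero.comp
      (hl.const_mul_atTop (by norm_num : (0 : ℝ) < 5))).const_mul K
  have hint := (integrable_exp_neg_mul_abs (c := 5) (by norm_num)).const_mul K
  have key := integral_horizontal_eq_of_differentiableOn hdiff hbound hint
    (hlim _ tendsto_abs_atTop_atTop) (hlim _ tendsto_abs_atBot_atTop)
  have hcont : ∀ y ∈ uIcc (-(1 / 2) : ℝ) (1 / 2), Integrable fun t : ℝ => f (t + y * Complex.I) := by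
    intro y hy
    refine hint.mono' (Continuous.aestronglyMeasurable ?_)
      (Eventually.of_forall fun t => hbound t y hy)
    refine hdiff.continuousOn.comp_continuous (by fun_prop) (fun t => ?_)
    simpa using hy
  have key2 := sub_eq_zero.2 key
  rw [← integral_sub (hcont _ left_mem_uIcc) (hcont _ right_mem_uIcc)] at key2
  rw [← neg_eq_zero, ← integral_neg, ← key2]
  refine integral_congr_ae (Eventually.of_forall fun t => ?_)
  simp only [hf]
  rw [shiftedPair_sub_half ha, shiftedPair_sub_half hb, shiftedPair_sub_half hc,
    shiftedPair_sub_half hd, shiftedPair_add_half ha, shiftedPair_add_half hb,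
    shiftedPair_add_half hc, shiftedPair_add_half hd]
  -- Moving by half a unit changes the argument of sinh by `πi`, so both edges carry the same sign
  -- `-1` and only the linear factors differ.
  have s1 : Complex.sinh (2 * Real.pi * (t + (-(1 / 2) : ℝ) * Complex.I))
      = -Complex.sinh (2 * Real.pi * t) := by
    rw [← Complex.sinh_sub_pi_mul_I]; congr 1; push_cast; ring
  have s2 : Complex.sinh (2 * Real.pi * (t + (1 / 2 : ℝ) * Complex.I))
      = -Complex.sinh (2 * Real.pi * t) := by
    rw [← Complex.sinh_add_pi_mul_I]; congr 1; push_cast; ring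
  rw [s1, s2]
  ring

/-- The contiguity relation of the de Branges–Wilson integral. -/
theorem wilsonIntegral_add_one {a b c d : ℂ} (ha : 0 < a.re) (hb : 0 < b.re) (hc : 0 < c.re)
    (hd : 0 < d.re) :
    (a + b + c + d) * wilsonIntegral (a + 1) b c d
      = (a + b) * (a + c) * (a + d) * wilsonIntegral a b c d := by
  have ha1 : 0 < (a + 1).re := by simp; linarith
  have key := integral_sinh_mul_shift ha hb hc hd
  unfold wilsonIntegral
  rw [← integral_const_mul, ← integral_const_mul, ← sub_eq_zero,
    ← integral_sub ((integrable_wilson ha1 hb hc hd).const_mul _)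
      ((integrable_wilson ha hb hc hd).const_mul _)]
  -- With `e₁`, `e₃` the elementary symmetric functions of the parameters, `(a+b)(a+c)(a+d) = a² e₁
  -- + e₃`. The polynomial factor left over is therefore `e₁ t² - e₃`, while the difference of
  -- products in `key` is `2i(e₃ t - e₁ t³)`; hence the factor `i/π`.
  rw [← mul_eq_zero_of_right (Complex.I / Real.pi) key, ← integral_const_mul]
  refine integral_congr_ae (Eventually.of_forall fun t => ?_)
  simp only [wilsonDensity]
  rw [gammaPair_add_one ha]
  push_cast
  have hpi : (Real.pi : ℂ) ≠ 0 := by exact_mod_cast Real.pi_ne_zero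
  field_simp
  have h2 := Complex.I_sq
  have h4 : Complex.I ^ 4 = 1 := by rw [Complex.I_pow_four]
  ring_nf
  simp only [h2, h4]
  ring

/-! ### Large parameter limit and independence of the parameters -/

/-- `Γ(z + n + 1) / (n ^ z n!)`, which tends to `1`. -/
noncomputable def gammaRatio (z : ℂ) (n : ℕ) : ℂ :=
  Complex.Gamma (z + (n + 1 : ℕ)) / ((n : ℂ) ^ z * (n.factorial : ℂ))

theorem Gamma_add_nat_eq_prod {z : ℂ} (hz : 0 < z.re) (n : ℕ) :
    Complex.Gamma (z + n) = (∏ j ∈ Finset.range n, (z + j)) * Complex.Gamma z := by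
  induction n with
  | zero => simp
  | succ n ih =>
    have h : z + n ≠ 0 := ne_zero_of_re_pos (by simp; positivity)
    rw [Finset.prod_range_succ, Nat.cast_succ, ← add_assoc, Complex.Gamma_add_one _ h, ih]
    ring

/-- This is Euler's limit formula: the ratio equals `Γ(z)` divided by `Complex.GammaSeq z n`. -/
theorem tendsto_gammaRatio {z : ℂ} (hz : 0 < z.re) :
    Tendsto (gammaRatio z) atTop (𝓝 1) := by
  have h0 := Complex.Gamma_ne_zero_of_re_pos hz
  have h := (tendsto_const_nhds (x := Complex.Gamma z)).div
    (Complex.GammaSeq_tendsto_Gamma z) h0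
  rw [div_self h0] at h
  refine h.congr' ?_
  filter_upwards with n
  simp only [Pi.div_apply, gammaRatio, Complex.GammaSeq]
  rw [Gamma_add_nat_eq_prod hz]
  rw [div_div_eq_mul_div]
  ring

/-- From `|Γ(z)| ≤ Γ(Re z)` and `|n ^ z| = n ^ Re z`. The bound does not involve the imaginary part,
so it is uniform in `t` and serves for dominated convergence. -/
theorem norm_gammaRatio_le {z : ℂ} (hz : 0 < z.re) {n : ℕ} (hn : n ≠ 0) :
    ‖gammaRatio z n‖ ≤ ‖gammaRatio z.re n‖ := by
  unfold gammaRatio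
  have h1 : 0 < (z + (n + 1 : ℕ)).re := by simp; positivity
  have h2 : ((z.re : ℂ) + (n + 1 : ℕ)) = ((z.re + (n + 1 : ℕ) : ℝ) : ℂ) := by push_cast; ring
  have h3 : (z + (n + 1 : ℕ)).re = z.re + (n + 1 : ℕ) := by simp
  have hn' : 0 < n := Nat.pos_of_ne_zero hn
  rw [norm_div, norm_div, norm_mul, norm_mul, Complex.norm_natCast_cpow_of_pos hn',
    Complex.norm_natCast_cpow_of_pos hn', Complex.ofReal_re, h2, Complex.Gamma_ofReal,
    Complex.norm_real]
  gcongr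
  rw [← h3]
  exact (norm_Gamma_le_Gamma_re h1).trans (Real.le_norm_self _)

theorem gammaPair_add_nat (a : ℂ) (t : ℝ) {n : ℕ} (hn : n ≠ 0) :
    gammaPair (a + (n + 1 : ℕ)) t / ((n : ℂ) ^ a * (n.factorial : ℂ)) ^ 2
      = gammaRatio (a + Complex.I * t) n * gammaRatio (a - Complex.I * t) n := by
  have hn' : (n : ℂ) ≠ 0 := Nat.cast_ne_zero.2 hn
  unfold gammaPair gammaRatio
  rw [div_mul_div_comm]
  congr 1
  · ring_nf
  · rw [mul_mul_mul_comm, ← Complex.cpow_add _ _ hn', mul_pow, sq, ← Complex.cpow_add _ _ hn']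
    ring_nf

/-- After normalisation the pair carrying `a` tends to `1` pointwise, so only the three-parameter
integral survives; its integrand, up to a constant, dominates. -/
theorem tendsto_wilsonIntegral_add_nat {a b c d : ℂ} (ha : 0 < a.re) (hb : 0 < b.re)
    (hc : 0 < c.re) (hd : 0 < d.re) :
    Tendsto (fun n : ℕ => wilsonIntegral (a + (n + 1 : ℕ)) b c d
      / ((n : ℂ) ^ a * (n.factorial : ℂ)) ^ 2) atTop (𝓝 (wilsonIntegral₃ b c d)) := by
  have hlim : ∀ t : ℝ, Tendsto (fun n => gammaRatio (a + Complex.I * t) n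
      * gammaRatio (a - Complex.I * t) n) atTop (𝓝 1) := by
    intro t
    simpa using (tendsto_gammaRatio (z := a + Complex.I * t) (by simpa using ha)).mul
      (tendsto_gammaRatio (z := a - Complex.I * t) (by simpa using ha))
  have hle : ∀ᶠ n : ℕ in atTop, ‖gammaRatio (a.re : ℂ) n‖ ≤ 2 := by
    have := (tendsto_gammaRatio (z := (a.re : ℂ)) (by simpa using ha)).norm
    rw [norm_one] at this
    exact this.eventually_le_const one_lt_two
  have hana : ∀ n : ℕ, 0 < (a + (n + 1 : ℕ)).re := fun n => by simp; positivity
  set B : ℝ := 8 * (gammaBound b.re ^ 2 * gammaBound c.re ^ 2 * gammaBound d.re ^ 2)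
  have key : Tendsto (fun n : ℕ => ∫ t : ℝ, (wilsonDensity t : ℂ)
      * (gammaPair (a + (n + 1 : ℕ)) t * gammaPair b t * gammaPair c t * gammaPair d t)
      / ((n : ℂ) ^ a * (n.factorial : ℂ)) ^ 2) atTop (𝓝 (wilsonIntegral₃ b c d)) := by
    refine tendsto_integral_filter_of_dominated_convergence
      (fun t => 4 * (B * Real.exp (-(1 * |t|)))) ?_ ?_
      (((integrable_exp_neg_mul_abs one_pos).const_mul _).const_mul _) ?_
    · exact Eventually.of_forall fun n =>
        ((continuous_wilson (hana n) hb hc hd).div_const _).aestronglyMeasurable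
    · filter_upwards [hle, eventually_ne_atTop 0] with n hn hn0
      refine Eventually.of_forall fun t => ?_
      have h1 := (norm_gammaRatio_le (z := a + Complex.I * t) (by simpa using ha) hn0)
      have h2 := (norm_gammaRatio_le (z := a - Complex.I * t) (by simpa using ha) hn0)
      rw [add_I_mul_re] at h1
      rw [sub_I_mul_re] at h2
      have h3 := norm_wilson₃_le hb hc hd t
      rw [neg_mul] at h3
      rw [show (wilsonDensity t : ℂ) * (gammaPair (a + (n + 1 : ℕ)) t * gammaPair b t
          * gammaPair c t * gammaPair d t) / ((n : ℂ) ^ a * (n.factorial : ℂ)) ^ 2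
          = (gammaPair (a + (n + 1 : ℕ)) t / ((n : ℂ) ^ a * (n.factorial : ℂ)) ^ 2)
          * ((wilsonDensity t : ℂ) * (gammaPair b t * gammaPair c t * gammaPair d t)) by ring,
        gammaPair_add_nat a t hn0, norm_mul, norm_mul, show (4 : ℝ) = 2 * 2 by norm_num]
      gcongr
      · exact h1.trans hn
      · exact h2.trans hn
    · refine Eventually.of_forall fun t => ?_
      have := (hlim t).mul_const
        ((wilsonDensity t : ℂ) * (gammaPair b t * gammaPair c t * gammaPair d t))
      rw [one_mul] at this
      refine this.congr' ?_
      filter_upwards [eventually_ne_atTop 0] with n hn0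
      rw [← gammaPair_add_nat a t hn0]
      ring
  refine key.congr fun n => ?_
  unfold wilsonIntegral
  rw [integral_div]

/-- Iterated contiguity, cleared of denominators. -/
theorem wilsonIntegral_add_nat {a b c d : ℂ} (ha : 0 < a.re) (hb : 0 < b.re) (hc : 0 < c.re)
    (hd : 0 < d.re) (n : ℕ) :
    wilsonIntegral (a + n) b c d * Complex.Gamma (a + b + c + d + n)
        * (Complex.Gamma (a + b) * Complex.Gamma (a + c) * Complex.Gamma (a + d))
      = wilsonIntegral a b c d * Complex.Gamma (a + b + c + d)
        * (Complex.Gamma (a + b + n) * Complex.Gamma (a + c + n) * Complex.Gamma (a + d + n)) := by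
  induction n with
  | zero => simp
  | succ n ih =>
    have han : 0 < (a + n).re := by simp; positivity
    have h := wilsonIntegral_add_one han hb hc hd
    have e : ∀ z : ℂ, 0 < z.re →
        Complex.Gamma (z + (n + 1 : ℕ)) = (z + n) * Complex.Gamma (z + n) := by
      intro z hz
      rw [Nat.cast_succ, ← add_assoc,
        Complex.Gamma_add_one _ (ne_zero_of_re_pos (by simp; positivity))]
    rw [e (a + b + c + d) (by simp; positivity), e (a + b) (by simp; positivity),
      e (a + c) (by simp; positivity), e (a + d) (by simp; positivity), Nat.cast_succ, ← add_assoc]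
    linear_combination (Complex.Gamma (a + b + c + d + n) * (Complex.Gamma (a + b)
      * Complex.Gamma (a + c) * Complex.Gamma (a + d))) * h
      + (a + b + n) * (a + c + n) * (a + d + n) * ih

theorem Gamma_add_nat_eq_gammaRatio (z : ℂ) {n : ℕ} (hn : n ≠ 0) :
    Complex.Gamma (z + (n + 1 : ℕ)) = gammaRatio z n * ((n : ℂ) ^ z * (n.factorial : ℂ)) := by
  have h1 : (n : ℂ) ^ z ≠ 0 := by simp [Complex.cpow_eq_zero_iff, hn]
  have h2 : (n.factorial : ℂ) ≠ 0 := Nat.cast_ne_zero.2 n.factorial_ne_zero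
  unfold gammaRatio
  rw [div_mul_cancel₀ _ (mul_ne_zero h1 h2)]

/-- Let `n → ∞` in the iterated contiguity relation: every shifted Gamma factor is replaced by its
asymptotic form, and the dependence on `a` becomes explicit. -/
theorem wilsonIntegral_mul_Gamma {a b c d : ℂ} (ha : 0 < a.re) (hb : 0 < b.re) (hc : 0 < c.re)
    (hd : 0 < d.re) :
    wilsonIntegral a b c d * Complex.Gamma (a + b + c + d)
      = Complex.Gamma (a + b) * Complex.Gamma (a + c) * Complex.Gamma (a + d)
        * wilsonIntegral₃ b c d := by
  have L := (((tendsto_wilsonIntegral_add_nat ha hb hc hd).mul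
    (tendsto_gammaRatio (z := a + b + c + d) (by simp; positivity))).mul_const
    (Complex.Gamma (a + b) * Complex.Gamma (a + c) * Complex.Gamma (a + d)))
  have R := ((((tendsto_gammaRatio (z := a + b) (by simp; positivity)).mul
    (tendsto_gammaRatio (z := a + c) (by simp; positivity))).mul
    (tendsto_gammaRatio (z := a + d) (by simp; positivity))).const_mul
    (wilsonIntegral a b c d * Complex.Gamma (a + b + c + d)))
  have := tendsto_nhds_unique (L.congr' ?_) R
  · rw [mul_one, mul_one, mul_one, mul_one] at this
    rw [← this]
    ring
  · filter_upwards [eventually_ne_atTop 0] with n hn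
    have hn' : (n : ℂ) ≠ 0 := Nat.cast_ne_zero.2 hn
    have h := wilsonIntegral_add_nat ha hb hc hd (n + 1)
    simp only [Gamma_add_nat_eq_gammaRatio _ hn, Complex.cpow_add _ _ hn'] at h
    have p : ∀ z : ℂ, (n : ℂ) ^ z ≠ 0 := fun z => by simp [Complex.cpow_eq_zero_iff, hn]
    have p1 := p a
    have p2 := p b
    have p3 := p c
    have p4 := p d
    have p5 : (n.factorial : ℂ) ≠ 0 := Nat.cast_ne_zero.2 n.factorial_ne_zero
    -- The asymptotic factors balance: both sides carry `n ^ (3a + b + c + d)` and `(n!)³`.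
    rw [div_mul_eq_mul_div, div_mul_eq_mul_div, div_eq_iff (by positivity)]
    refine mul_right_cancel₀ (mul_ne_zero (mul_ne_zero (mul_ne_zero (mul_ne_zero p1 p2) p3) p4) p5) ?_
    linear_combination h

/-- The quotient of the two sides of the de Branges–Wilson formula does not depend on the
parameters. -/
theorem wilsonIntegral_ratio_eq {a b c d : ℂ} (ha : 0 < a.re) (hb : 0 < b.re) (hc : 0 < c.re)
    (hd : 0 < d.re) {e : ℂ} (he : 0 < e.re) :
    wilsonIntegral a b c d * Complex.Gamma (a + b + c + d)
        / (Complex.Gamma (a + b) * Complex.Gamma (a + c) * Complex.Gamma (a + d)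
          * Complex.Gamma (b + c) * Complex.Gamma (b + d) * Complex.Gamma (c + d))
      = wilsonIntegral e (1 / 2) (1 / 2) (1 / 2) * Complex.Gamma (e + 1 / 2 + 1 / 2 + 1 / 2)
        / (Complex.Gamma (e + 1 / 2) ^ 3 * Complex.Gamma 1 ^ 3) := by
  set N : ℂ → ℂ → ℂ → ℂ → ℂ := fun a b c d =>
    wilsonIntegral a b c d * Complex.Gamma (a + b + c + d)
        / (Complex.Gamma (a + b) * Complex.Gamma (a + c) * Complex.Gamma (a + d)
          * Complex.Gamma (b + c) * Complex.Gamma (b + d) * Complex.Gamma (c + d)) with hN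
  have hG : ∀ {x y : ℂ}, 0 < x.re → 0 < y.re → Complex.Gamma (x + y) ≠ 0 := fun hx hy =>
    Complex.Gamma_ne_zero_of_re_pos (by simp; positivity)
  -- The three Gamma factors containing `a` cancel against `wilsonIntegral_mul_Gamma`, leaving an
  -- expression in `b`, `c`, `d` alone. By symmetry each parameter can be brought to the front and
  -- replaced in turn.
  have hfirst : ∀ {a a' b c d : ℂ}, 0 < a.re → 0 < a'.re → 0 < b.re → 0 < c.re → 0 < d.re →
      N a b c d = N a' b c d := by
    have h1 : ∀ {a b c d : ℂ}, 0 < a.re → 0 < b.re → 0 < c.re → 0 < d.re →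
        N a b c d = wilsonIntegral₃ b c d
          / (Complex.Gamma (b + c) * Complex.Gamma (b + d) * Complex.Gamma (c + d)) := by
      intro a b c d ha hb hc hd
      simp only [hN]
      rw [wilsonIntegral_mul_Gamma ha hb hc hd]
      have := hG ha hb
      have := hG ha hc
      have := hG ha hd
      have := hG hb hc
      have := hG hb hd
      have := hG hc hd
      field_simp
    intro a a' b c d ha ha' hb hc hd
    rw [h1 ha hb hc hd, h1 ha' hb hc hd]
  have hW : ∀ a b c d, wilsonIntegral a b c d = wilsonIntegral b a c d ∧
      wilsonIntegral a b c d = wilsonIntegral c b a d ∧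
      wilsonIntegral a b c d = wilsonIntegral d b c a := by
    intro a b c d
    refine ⟨?_, ?_, ?_⟩ <;>
    · refine integral_congr_ae (Eventually.of_forall fun t => ?_)
      simp only
      ring
  have hswap : ∀ a b c d, N a b c d = N b a c d ∧ N a b c d = N c b a d ∧
      N a b c d = N d b c a := by
    intro a b c d
    obtain ⟨w1, w2, w3⟩ := hW a b c d
    simp only [hN]
    refine ⟨?_, ?_, ?_⟩
    · rw [w1, show a + b + c + d = b + a + c + d by ring, add_comm a b]
      ring
    · rw [w2, show a + b + c + d = c + b + a + d by ring, add_comm c b, add_comm c a,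
        add_comm b a]
      ring
    · rw [w3, show a + b + c + d = d + b + c + a by ring, add_comm d b, add_comm d c, add_comm d a,
        add_comm b a, add_comm c a]
      ring
  have hh : (0 : ℝ) < (1 / 2 : ℂ).re := by norm_num
  have hfin : N a b c d = N e (1 / 2) (1 / 2) (1 / 2) := by
    rw [(hswap a b c d).1, hfirst hb hh ha hc hd, (hswap _ _ _ _).1,
      (hswap a (1 / 2) c d).2.1, hfirst hc hh hh ha hd, (hswap _ _ _ _).2.1,
      (hswap a (1 / 2) (1 / 2) d).2.2, hfirst hd hh hh hh ha, (hswap _ _ _ _).2.2,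
      hfirst ha he hh hh hh]
  change N a b c d = _
  rw [hfin]
  simp only [hN]
  rw [add_halves]
  ring

/-! ### The constant in the de Branges–Wilson formula -/

theorem gammaPair_half (t : ℝ) :
    gammaPair (1 / 2) t = ((Real.pi / Real.cosh (Real.pi * t) : ℝ) : ℂ) := by
  unfold gammaPair
  rw [show (1 / 2 - Complex.I * t : ℂ) = 1 - (1 / 2 + Complex.I * t) by ring,
    Complex.Gamma_mul_Gamma_one_sub, show (Real.pi : ℂ) * (1 / 2 + Complex.I * t)
      = Real.pi * t * Complex.I + Real.pi / 2 by ring, Complex.sin_add_pi_div_two,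
      Complex.cos_mul_I]
  push_cast
  rfl

theorem gammaPair_one {t : ℝ} (ht : t ≠ 0) :
    gammaPair 1 t = ((Real.pi * t / Real.sinh (Real.pi * t) : ℝ) : ℂ) := by
  unfold gammaPair
  have h : Complex.I * t ≠ 0 := mul_ne_zero Complex.I_ne_zero (Complex.ofReal_ne_zero.2 ht)
  rw [add_comm, Complex.Gamma_add_one _ h, mul_assoc, Complex.Gamma_mul_Gamma_one_sub,
    show (Real.pi : ℂ) * (Complex.I * t) = Real.pi * t * Complex.I by ring, Complex.sin_mul_I]
  push_cast
  rw [mul_div_assoc', mul_comm (Complex.sinh _), mul_assoc, mul_div_mul_left _ _ Complex.I_ne_zero,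
    mul_comm (t : ℂ)]

theorem integral_inv_cosh_sq : ∫ t : ℝ, (1 / Real.cosh (Real.pi * t) ^ 2 : ℝ) = 2 / Real.pi := by
  have hpi := Real.pi_pos
  -- The antiderivative is `tanh(πt)/π - 1/π`, written to have limit `0` at `+∞`.
  have hderiv : ∀ t : ℝ, HasDerivAt (fun t : ℝ => -(2 / Real.pi) / (Real.exp (2 * Real.pi * t) + 1))
      (1 / Real.cosh (Real.pi * t) ^ 2) t := by
    intro t
    have h1 : HasDerivAt (fun t : ℝ => Real.exp (2 * Real.pi * t) + 1)
        (Real.exp (2 * Real.pi * t) * (2 * Real.pi * 1)) t :=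
      (((hasDerivAt_id t).const_mul (2 * Real.pi)).exp).add_const 1
    have h2 := (hasDerivAt_const t (-(2 / Real.pi))).div h1 (by positivity)
    refine h2.congr_deriv ?_
    have e1 : Real.exp (2 * Real.pi * t) = Real.exp (Real.pi * t) ^ 2 := by
      rw [← Real.exp_nat_mul]; push_cast; ring_nf
    rw [Real.cosh_eq, Real.exp_neg, e1]
    have := Real.exp_pos (Real.pi * t)
    field_simp
    ring
  have hbot : Tendsto (fun t : ℝ => -(2 / Real.pi) / (Real.exp (2 * Real.pi * t) + 1)) atBot
      (𝓝 (-(2 / Real.pi))) := by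
    have := (Real.tendsto_exp_atBot.comp
      (tendsto_id.const_mul_atBot (by positivity : 0 < 2 * Real.pi))).add_const 1
    rw [zero_add] at this
    have h := (tendsto_const_nhds (x := -(2 / Real.pi))).div this one_ne_zero
    rw [div_one] at h
    exact h
  have htop : Tendsto (fun t : ℝ => -(2 / Real.pi) / (Real.exp (2 * Real.pi * t) + 1)) atTop
      (𝓝 0) :=
    (tendsto_const_nhds (x := -(2 / Real.pi))).div_atTop (tendsto_atTop_add_const_right _ 1
      (Real.tendsto_exp_atTop.comp
        (tendsto_id.const_mul_atTop (by positivity : 0 < 2 * Real.pi))))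
  have hint : Integrable fun t : ℝ => 1 / Real.cosh (Real.pi * t) ^ 2 := by
    refine ((integrable_exp_neg_mul_abs one_pos).const_mul 4).mono'
      (Continuous.aestronglyMeasurable ?_) (Eventually.of_forall fun t => ?_)
    · exact continuous_const.div (by fun_prop) fun t => (pow_pos (Real.cosh_pos _) 2).ne'
    · rw [Real.norm_of_nonneg (by positivity), div_le_iff₀ (by positivity), ← Real.cosh_abs,
        Real.cosh_eq, abs_mul, abs_of_pos hpi]
      have h1 : Real.exp |t| ≤ Real.exp (Real.pi * |t|) ^ 2 := by
        rw [← Real.exp_nat_mul]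
        refine Real.exp_le_exp.2 ?_
        push_cast
        nlinarith [abs_nonneg t, Real.pi_gt_three]
      have h2 : Real.exp (-(1 * |t|)) * Real.exp |t| = 1 := by
        rw [← Real.exp_add]; simp
      have h3 := Real.exp_pos (-(Real.pi * |t|))
      have h4 := Real.exp_pos (Real.pi * |t|)
      have h5 := Real.exp_pos (-(1 * |t|))
      calc (1 : ℝ) = Real.exp (-(1 * |t|)) * Real.exp |t| := h2.symm
        _ ≤ Real.exp (-(1 * |t|)) * (Real.exp (Real.pi * |t|) + Real.exp (-(Real.pi * |t|))) ^ 2 := by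
          gcongr
          nlinarith
        _ = _ := by ring
  rw [integral_of_hasDerivAt_of_tendsto hderiv hint hbot htop]
  ring

/-- As `a → 0` the first pair tends to `gammaPair 1 t / t²` for `t ≠ 0`. With the other parameters
`1/2`, the reflection formula turns the limiting integrand into `4π³ / cosh²(πt)`. -/
theorem tendsto_wilsonIntegral_nhds_zero :
    Tendsto (fun n : ℕ => wilsonIntegral (1 / ((n : ℝ) + 1) : ℝ) (1 / 2) (1 / 2) (1 / 2)) atTop
      (𝓝 ((8 * Real.pi ^ 2 : ℝ) : ℂ)) := by
  have hpi := Real.pi_pos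
  have hval : ((8 * Real.pi ^ 2 : ℝ) : ℂ)
      = ∫ t : ℝ, ((4 * Real.pi ^ 3 * (1 / Real.cosh (Real.pi * t) ^ 2) : ℝ) : ℂ) := by
    rw [integral_complex_ofReal, integral_const_mul, integral_inv_cosh_sq]
    congr 1
    field_simp
    ring
  rw [hval]
  obtain ⟨M, hM⟩ := exists_gammaBound_le one_pos
  have hh : (0 : ℝ) < (1 / 2 : ℂ).re := by norm_num
  set H : ℝ := gammaBound (1 / 2 : ℂ).re ^ 2 * gammaBound (1 / 2 : ℂ).re ^ 2
    * gammaBound (1 / 2 : ℂ).re ^ 2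
  set ε : ℕ → ℝ := fun n => 1 / ((n : ℝ) + 1) with hε
  have hεpos : ∀ n, 0 < ε n := fun n => by simp only [hε]; positivity
  have hεle : ∀ n, ε n ≤ 1 := fun n => by
    simp only [hε]
    rw [div_le_one (by positivity)]
    linarith [n.cast_nonneg (α := ℝ)]
  have hεlim : Tendsto ε atTop (𝓝 0) := tendsto_one_div_add_atTop_nhds_zero_nat
  have hpair : ∀ n (t : ℝ), t ≠ 0 → gammaPair (ε n) t
      = gammaPair (ε n + 1) t / ((ε n : ℂ) ^ 2 + (t : ℂ) ^ 2) := by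
    intro n t ht
    rw [gammaPair_add_one (by simpa using hεpos n), mul_div_cancel_left₀]
    have : (ε n ^ 2 + t ^ 2 : ℝ) ≠ 0 := by positivity
    exact_mod_cast this
  have hne : ∀ᵐ t : ℝ, t ≠ 0 := by
    rw [ae_iff]
    simp
  refine tendsto_integral_filter_of_dominated_convergence
    (fun t => 4 * M ^ 2 * H * Real.exp (-(5 * |t|))) ?_ ?_
    ((integrable_exp_neg_mul_abs (by norm_num)).const_mul _) ?_
  · exact Eventually.of_forall fun n =>
      (continuous_wilson (by rw [Complex.ofReal_re]; exact hεpos n) hh hh hh).aestronglyMeasurable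
  · refine Eventually.of_forall fun n => ?_
    filter_upwards [hne] with t ht
    have ht2 : 0 < t ^ 2 := by positivity
    -- The functional equation moves the parameter into `[1, 2]`, where `M` bounds `gammaBound`; the
    -- remaining `1 / t²` is cancelled by the density.
    have h1 : ‖gammaPair (ε n) t‖ ≤ M ^ 2 * Real.exp (-3 * |t|) / t ^ 2 := by
      rw [hpair n t ht, norm_div]
      have hre : ((ε n : ℂ) + 1).re = ε n + 1 := by simp
      have h2 := norm_gammaPair_le' (a := (ε n : ℂ) + 1) (by rw [hre]; linarith [hεpos n]) t
      have h3 : ‖(ε n : ℂ) ^ 2 + (t : ℂ) ^ 2‖ = ε n ^ 2 + t ^ 2 := by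
        rw [← Complex.ofReal_pow, ← Complex.ofReal_pow, ← Complex.ofReal_add, Complex.norm_real,
          Real.norm_of_nonneg (by positivity)]
      rw [h3]
      rw [hre] at h2
      have h4 := hM (ε n + 1) ⟨by linarith [hεpos n], by linarith [hεle n]⟩
      have h5 := gammaBound_nonneg (σ := ε n + 1) (by linarith [hεpos n])
      refine div_le_div₀ (by positivity) (h2.trans ?_) ht2 (by linarith [sq_nonneg (ε n)])
      gcongr
    have h2 := norm_gammaPair₃_le hh hh hh t
    have h3 : ‖(wilsonDensity t : ℂ)‖ ≤ t ^ 2 * (4 * Real.exp (7 * |t|)) := by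
      rw [Complex.norm_real]; exact abs_wilsonDensity_le_sq t
    rw [show (wilsonDensity t : ℂ) * (gammaPair (ε n) t * gammaPair (1 / 2) t * gammaPair (1 / 2) t
      * gammaPair (1 / 2) t) = wilsonDensity t * gammaPair (ε n) t
        * (gammaPair (1 / 2) t * gammaPair (1 / 2) t * gammaPair (1 / 2) t) by ring,
        norm_mul, norm_mul]
    calc _ ≤ t ^ 2 * (4 * Real.exp (7 * |t|)) * (M ^ 2 * Real.exp (-3 * |t|) / t ^ 2)
          * (H * Real.exp (-9 * |t|)) := by gcongr
      _ = 4 * M ^ 2 * H * (Real.exp (7 * |t|) * Real.exp (-3 * |t|) * Real.exp (-9 * |t|)) := by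
          field_simp
      _ = _ := by rw [← Real.exp_add, ← Real.exp_add]; ring_nf
  · filter_upwards [hne] with t ht
    have hlim : Tendsto (fun n => gammaPair (ε n) t) atTop
        (𝓝 (gammaPair 1 t / ((0 : ℝ) ^ 2 + (t : ℂ) ^ 2))) := by
      refine Tendsto.congr (fun n => (hpair n t ht).symm) ?_
      have hz : Tendsto (fun n => (ε n : ℂ)) atTop (𝓝 ((0 : ℝ) : ℂ)) :=
        (Complex.continuous_ofReal.tendsto 0).comp hεlim
      refine Tendsto.div ?_ ((hz.pow 2).add_const _) ?_
      · have hc : ContinuousAt (fun a : ℂ => gammaPair a t) 1 := by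
          unfold gammaPair
          refine ContinuousAt.mul ?_ ?_
          · refine ContinuousAt.comp (f := fun a : ℂ => a + Complex.I * t)
              (differentiableAt_Gamma_of_re_pos (by simp)).continuousAt (by fun_prop)
          · refine ContinuousAt.comp (f := fun a : ℂ => a - Complex.I * t)
              (differentiableAt_Gamma_of_re_pos (by simp)).continuousAt (by fun_prop)
        have h1 : Tendsto (fun n => (ε n : ℂ) + 1) atTop (𝓝 1) := by
          simpa using hz.add_const 1
        exact hc.tendsto.comp h1
      · simpa using ht
    have := (((hlim.mul_const (gammaPair (1 / 2) t)).mul_const (gammaPair (1 / 2) t)).mul_const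
      (gammaPair (1 / 2) t)).const_mul (wilsonDensity t : ℂ)
    convert this using 2
    rw [gammaPair_one ht, gammaPair_half]
    unfold wilsonDensity
    have e1 : Real.sinh (2 * Real.pi * t) = 2 * Real.sinh (Real.pi * t) * Real.cosh (Real.pi * t) := by
      rw [mul_assoc, Real.sinh_two_mul]
    have e2 : Real.sinh (Real.pi * t) ≠ 0 := by
      rw [Ne, Real.sinh_eq_zero]; positivity
    have e3 := (Real.cosh_pos (Real.pi * t)).ne'
    rw [e1]
    norm_cast
    field_simp
    ring

/-- The de Branges–Wilson integral. -/
theorem wilsonIntegral_eq {a b c d : ℂ} (ha : 0 < a.re) (hb : 0 < b.re) (hc : 0 < c.re)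
    (hd : 0 < d.re) :
    wilsonIntegral a b c d = 4 * Real.pi * (Complex.Gamma (a + b) * Complex.Gamma (a + c)
      * Complex.Gamma (a + d) * Complex.Gamma (b + c) * Complex.Gamma (b + d)
      * Complex.Gamma (c + d)) / Complex.Gamma (a + b + c + d) := by
  have hG : ∀ {x y : ℂ}, 0 < x.re → 0 < y.re → Complex.Gamma (x + y) ≠ 0 := fun hx hy =>
    Complex.Gamma_ne_zero_of_re_pos (by simp; positivity)
  have h0 : Complex.Gamma (a + b + c + d) ≠ 0 :=
    Complex.Gamma_ne_zero_of_re_pos (by simp; positivity)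
  have hsix := mul_ne_zero (mul_ne_zero (mul_ne_zero (mul_ne_zero (mul_ne_zero (hG ha hb)
    (hG ha hc)) (hG ha hd)) (hG hb hc)) (hG hb hd)) (hG hc hd)
  suffices h : wilsonIntegral a b c d * Complex.Gamma (a + b + c + d)
        / (Complex.Gamma (a + b) * Complex.Gamma (a + c) * Complex.Gamma (a + d)
          * Complex.Gamma (b + c) * Complex.Gamma (b + d) * Complex.Gamma (c + d))
      = 4 * Real.pi by
    rw [eq_div_iff h0]
    rwa [div_eq_iff hsix] at h
  have hlim : Tendsto (fun n : ℕ => wilsonIntegral (1 / ((n : ℝ) + 1) : ℝ) (1 / 2) (1 / 2) (1 / 2)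
      * Complex.Gamma ((1 / ((n : ℝ) + 1) : ℝ) + 1 / 2 + 1 / 2 + 1 / 2)
        / (Complex.Gamma ((1 / ((n : ℝ) + 1) : ℝ) + 1 / 2) ^ 3 * Complex.Gamma 1 ^ 3)) atTop
      (𝓝 (((8 * Real.pi ^ 2 : ℝ) : ℂ) * Complex.Gamma ((0 : ℝ) + 1 / 2 + 1 / 2 + 1 / 2)
        / (Complex.Gamma ((0 : ℝ) + 1 / 2) ^ 3 * Complex.Gamma 1 ^ 3))) := by
    have hz : Tendsto (fun n : ℕ => ((1 / ((n : ℝ) + 1) : ℝ) : ℂ)) atTop (𝓝 ((0 : ℝ) : ℂ)) :=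
      (Complex.continuous_ofReal.tendsto 0).comp tendsto_one_div_add_atTop_nhds_zero_nat
    refine Tendsto.div (tendsto_wilsonIntegral_nhds_zero.mul ?_) (Tendsto.mul_const _
      (Tendsto.pow ?_ 3)) ?_
    · exact (differentiableAt_Gamma_of_re_pos (by norm_num)).continuousAt.tendsto.comp
        (((hz.add_const _).add_const _).add_const _)
    · exact (differentiableAt_Gamma_of_re_pos (by norm_num)).continuousAt.tendsto.comp
        (hz.add_const _)
    · exact mul_ne_zero (pow_ne_zero _ (Complex.Gamma_ne_zero_of_re_pos (by norm_num)))
        (pow_ne_zero _ (Complex.Gamma_ne_zero_of_re_pos (by norm_num)))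
  have hconst := tendsto_nhds_unique (hlim.congr fun n =>
    (wilsonIntegral_ratio_eq ha hb hc hd (by rw [Complex.ofReal_re]; positivity)).symm)
    tendsto_const_nhds
  rw [← hconst]
  -- This is `Γ(1/2)² = π`. With `Γ(3/2) = Γ(1/2)/2`, the limit `8π² Γ(3/2) / Γ(1/2)³` equals `4π`.
  have hg := gammaPair_half 0
  simp only [gammaPair, Complex.ofReal_zero, mul_zero, add_zero, sub_zero, Real.cosh_zero,
    div_one] at hg
  have hne : Complex.Gamma (1 / 2) ≠ 0 := Complex.Gamma_ne_zero_of_re_pos (by norm_num)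
  rw [show ((0 : ℝ) : ℂ) + 1 / 2 + 1 / 2 + 1 / 2 = 1 / 2 + 1 by push_cast; ring,
    show ((0 : ℝ) : ℂ) + 1 / 2 = 1 / 2 by push_cast; ring,
    Complex.Gamma_add_one _ (by norm_num), Complex.Gamma_one]
  push_cast
  rw [← hg]
  field_simp
  norm_num

/-! ### Mellin inversion of the exponential and the Beta integral -/

theorem integrable_Gamma_vertical {c : ℂ} (hc : 0 < c.re) :
    Integrable fun τ : ℝ => Complex.Gamma (c - Complex.I * τ) := by
  have h := ((integrable_exp_neg_mul_abs (c := 3 / 2) (by norm_num)).const_mul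
    (gammaBound c.re)).comp_sub_left c.im
  refine h.mono' (continuous_Gamma_comp (by fun_prop)
    fun t => by simpa using hc).aestronglyMeasurable (Eventually.of_forall fun t => ?_)
  have := norm_Gamma_le (s := c - Complex.I * t) (by simpa using hc)
  rwa [sub_I_mul_re, sub_I_mul_im] at this

/-- Mellin inversion for the exponential function, in logarithmic coordinates. -/
theorem integral_Gamma_mul_exp {c : ℂ} (hc : 0 < c.re) (y : ℝ) :
    ∫ τ : ℝ, Complex.Gamma (c - Complex.I * τ) * Complex.exp (-(c - Complex.I * τ) * y)
      = 2 * Real.pi * (Real.exp (-Real.exp y) : ℝ) := by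
  have hmell : ∀ s : ℂ, 0 < s.re →
      mellin (fun x : ℝ => ((Real.exp (-x) : ℝ) : ℂ)) s = Complex.Gamma s := by
    intro s hs
    rw [← Complex.GammaIntegral_eq_mellin, Complex.Gamma_eq_integral hs]
  have hσ : ∀ t : ℝ, 0 < ((c.re : ℂ) + t * Complex.I).re := fun t => by simpa using hc
  -- The reflection `τ = c.im - t` carries the line `c - iτ` to the standard one of abscissa `c.re`.
  have hrefl : ∀ t : ℝ, c - Complex.I * ((c.im - t : ℝ) : ℂ) = (c.re : ℂ) + t * Complex.I := by
    intro t
    apply Complex.ext <;> simp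
  have h := mellinInv_mellin_eq c.re (fun x : ℝ => ((Real.exp (-x) : ℝ) : ℂ)) (Real.exp_pos y)
    (by
      have := Complex.GammaIntegral_convergent (s := (c.re : ℂ)) (by simpa using hc)
      refine this.congr_fun (fun x _ => ?_) measurableSet_Ioi
      simp only [smul_eq_mul]
      rw [mul_comm])
    (by
      have h2 := (integrable_Gamma_vertical hc).comp_sub_left c.im
      refine h2.congr (Eventually.of_forall fun t => ?_)
      simp only
      rw [hmell _ (hσ t), hrefl])
    (by fun_prop)
  rw [mellinInv] at h
  rw [← integral_sub_left_eq_self _ _ c.im]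
  simp_rw [hrefl]
  rw [Complex.real_smul] at h
  rw [← h, ← mul_assoc]
  have hpi : (Real.pi : ℂ) ≠ 0 := by exact_mod_cast Real.pi_ne_zero
  rw [show (2 * Real.pi * ((1 / (2 * Real.pi) : ℝ) : ℂ)) = 1 by push_cast; field_simp, one_mul]
  refine integral_congr_ae (Eventually.of_forall fun t => ?_)
  simp only [smul_eq_mul]
  rw [hmell _ (hσ t), ofReal_exp_cpow]
  ring

/-- The Beta integral in logarithmic coordinates. -/
theorem integrable_and_integral_beta {u v : ℂ} (hu : 0 < u.re) (hv : 0 < v.re) :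
    Integrable (fun R : ℝ => Complex.exp (u * R - (u + v) * Real.log (1 + Real.exp R))) ∧
    ∫ R : ℝ, Complex.exp (u * R - (u + v) * Real.log (1 + Real.exp R))
      = Complex.Gamma u * Complex.Gamma v / Complex.Gamma (u + v) := by
  have huv : 0 < (u + v).re := by simp; positivity
  have hG := Complex.Gamma_ne_zero_of_re_pos huv
  set f : ℝ × ℝ → ℂ := fun p => Complex.exp (u * p.1 - (Real.exp p.1 : ℝ))
    * Complex.exp (v * p.2 - (Real.exp p.2 : ℝ)) with hf
  have hfi : Integrable f (volume.prod volume) :=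
    (integrable_exp_mul_sub_exp hu).mul_prod (integrable_exp_mul_sub_exp hv)
  have hfI : ∫ p, f p ∂(volume.prod volume) = Complex.Gamma u * Complex.Gamma v := by
    have h1 := integral_exp_mul_sub_mul_exp hu one_pos
    have h2 := integral_exp_mul_sub_mul_exp hv one_pos
    simp only [Complex.ofReal_one, one_mul, Real.log_one, Complex.ofReal_zero, mul_zero,
      Complex.exp_zero] at h1 h2
    exact (integral_prod_mul (fun p : ℝ => Complex.exp (u * p - (Real.exp p : ℝ)))
      (fun p : ℝ => Complex.exp (v * p - (Real.exp p : ℝ)))).trans (by rw [h1, h2])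
  -- In the double integral for `Γ(u) Γ(v)`, the shear `(R, b) ↦ (R + b, b)` makes the integral over
  -- `b` a Gamma integral with `m = 1 + e^R`.
  have hmp := measurePreserving_add_prod (volume : Measure ℝ) (volume : Measure ℝ)
  have hme : MeasurableEmbedding fun p : ℝ × ℝ => (p.1 + p.2, p.2) := by
    refine (Homeomorph.mk (Equiv.mk (fun p : ℝ × ℝ => (p.1 + p.2, p.2))
      (fun p => (p.1 - p.2, p.2)) (fun p => by simp) (fun p => by simp)) ?_
      ?_).measurableEmbedding <;> fun_prop
  have hgi : Integrable (fun p : ℝ × ℝ => f (p.1 + p.2, p.2)) (volume.prod volume) :=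
    (hmp.integrable_comp_emb hme).2 hfi
  have hgI := hmp.integral_comp hme f
  have hinner : ∀ R : ℝ, ∫ b : ℝ, f (R + b, b)
      = Complex.exp (u * R - (u + v) * Real.log (1 + Real.exp R)) * Complex.Gamma (u + v) := by
    intro R
    have hm : 0 < 1 + Real.exp R := by positivity
    rw [show u * R - (u + v) * Real.log (1 + Real.exp R)
      = u * R + -(u + v) * Real.log (1 + Real.exp R) by ring, Complex.exp_add, mul_assoc,
      ← integral_exp_mul_sub_mul_exp huv hm, ← integral_const_mul]
    refine integral_congr_ae (Eventually.of_forall fun b => ?_)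
    simp only [hf]
    rw [← Complex.exp_add, ← Complex.exp_add, Real.exp_add]
    push_cast
    ring_nf
  have hI := hgi.integral_prod_left
  simp only [hinner] at hI
  rw [integral_prod _ hgi, hfI] at hgI
  simp only [hinner] at hgI
  refine ⟨?_, ?_⟩
  · refine (hI.mul_const (Complex.Gamma (u + v))⁻¹).congr (Eventually.of_forall fun R => ?_)
    simp only
    rw [mul_assoc, mul_inv_cancel₀ hG, mul_one]
  · rw [eq_div_iff hG, ← integral_mul_const, hgI]

/-! ### The Givental integral without its outer factors -/

/-- The part of the Givental integrand that is left after Mellin inversion in `x₁` and `x₃`, at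
`x₂ = 0`. -/
noncomputable def coreIntegrand (A B C : ℂ) : ℝ × ℝ × ℝ → ℂ := fun T =>
  Complex.exp (A * T.2.1 + B * T.2.2 + C * T.1 - (Real.exp T.2.1 : ℝ) - (Real.exp (-T.2.2) : ℝ)
    - (Real.exp (T.2.1 - T.1) : ℝ) - (Real.exp (T.1 - T.2.2) : ℝ))

/-- With `T₁₁ = R` frozen, `T₂₁` and `T₂₂` decouple: `e^p + e^(p-R) = (1 + e^(-R)) e^p`, and
similarly in `-q`. -/
theorem coreIntegrand_eq_mul (A B C : ℂ) (R p q : ℝ) :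
    coreIntegrand A B C (R, p, q) = Complex.exp (C * R)
      * (Complex.exp (A * p - ((1 + Real.exp (-R) : ℝ) : ℂ) * (Real.exp p : ℝ))
      * Complex.exp (-B * (-q : ℝ) - ((1 + Real.exp R : ℝ) : ℂ) * (Real.exp (-q) : ℝ))) := by
  unfold coreIntegrand
  rw [← Complex.exp_add, ← Complex.exp_add]
  simp only [Real.exp_sub, Real.exp_neg, div_eq_mul_inv]
  push_cast
  ring_nf

theorem continuous_coreIntegrand (A B C : ℂ) : Continuous (coreIntegrand A B C) := by
  unfold coreIntegrand
  fun_prop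

theorem integrable_coreIntegrand_fiber {A B : ℂ} (C : ℂ) (hA : 0 < A.re) (hB : 0 < (-B).re)
    (R : ℝ) : Integrable fun p : ℝ × ℝ => coreIntegrand A B C (R, p) := by
  have h1 := integrable_exp_mul_sub_mul_exp hA (m := 1 + Real.exp (-R)) (by positivity)
  have h2 := (integrable_exp_mul_sub_mul_exp hB (m := 1 + Real.exp R) (by positivity)).comp_neg
  refine ((h1.mul_prod h2).const_mul (Complex.exp (C * R))).congr
    (Eventually.of_forall fun p => ?_)
  simp only
  rw [← coreIntegrand_eq_mul]

theorem log_one_add_exp_neg (R : ℝ) :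
    Real.log (1 + Real.exp (-R)) = Real.log (1 + Real.exp R) - R := by
  have h : 1 + Real.exp (-R) = (1 + Real.exp R) / Real.exp R := by
    rw [Real.exp_neg]
    field_simp
    ring
  rw [h, Real.log_div (by positivity) (Real.exp_pos R).ne', Real.log_exp]

/-- Two Gamma integrals; rewriting `log (1 + e^(-R))` by `log (1 + e^R)` gives the Beta integrand
with `u = A + C`, `v = -B - C`. -/
theorem integral_coreIntegrand_fiber {A B : ℂ} (C : ℂ) (hA : 0 < A.re) (hB : 0 < (-B).re)
    (R : ℝ) : ∫ p : ℝ × ℝ, coreIntegrand A B C (R, p)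
      = Complex.exp ((A + C) * R - ((A + C) + (-B - C)) * Real.log (1 + Real.exp R))
        * (Complex.Gamma A * Complex.Gamma (-B)) := by
  have h1 := integral_exp_mul_sub_mul_exp hA (m := 1 + Real.exp (-R)) (by positivity)
  have h2 := integral_exp_mul_sub_mul_exp hB (m := 1 + Real.exp R) (by positivity)
  rw [← integral_neg_eq_self] at h2
  have : ∫ p : ℝ × ℝ, coreIntegrand A B C (R, p) = Complex.exp (C * R)
      * ((∫ p : ℝ, Complex.exp (A * p - ((1 + Real.exp (-R) : ℝ) : ℂ) * (Real.exp p : ℝ)))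
      * ∫ q : ℝ, Complex.exp (-B * (-q : ℝ) - ((1 + Real.exp R : ℝ) : ℂ)
        * (Real.exp (-q) : ℝ))) := by
    rw [← integral_prod_mul, ← integral_const_mul]
    refine integral_congr_ae (Eventually.of_forall fun p => ?_)
    simp only
    rw [← coreIntegrand_eq_mul]
  rw [this, h1, h2, log_one_add_exp_neg, mul_mul_mul_comm (Complex.exp _), ← mul_assoc,
    ← Complex.exp_add, ← Complex.exp_add]
  congr 2
  push_cast
  ring

/-- The norm belongs to the same family, so the fiber formula also computes the integrals of norms
needed for absolute convergence. -/
theorem norm_coreIntegrand (A B C : ℂ) (T : ℝ × ℝ × ℝ) :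
    ((‖coreIntegrand A B C T‖ : ℝ) : ℂ) = coreIntegrand A.re B.re C.re T := by
  unfold coreIntegrand
  rw [Complex.norm_exp, Complex.ofReal_exp]
  congr 1
  apply Complex.ext
  · simp only [Complex.ofReal_re, Complex.sub_re, Complex.add_re, Complex.mul_re,
      Complex.ofReal_im, mul_zero, sub_zero]
  · simp [-Complex.ofReal_exp]

theorem integrable_coreIntegrand {A B C : ℂ} (hA : 0 < A.re) (hB : 0 < (-B).re)
    (hAC : 0 < (A + C).re) (hBC : 0 < (-B - C).re) : Integrable (coreIntegrand A B C) := by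
  rw [Measure.volume_eq_prod, integrable_prod_iff
    (continuous_coreIntegrand A B C).aestronglyMeasurable]
  refine ⟨Eventually.of_forall fun R => integrable_coreIntegrand_fiber C hA hB R, ?_⟩
  have hA' : 0 < ((A.re : ℝ) : ℂ).re := by simpa using hA
  have hB' : 0 < (-((B.re : ℝ) : ℂ)).re := by simpa using hB
  have h := ((integrable_and_integral_beta (u := (A.re : ℂ) + C.re) (v := -(B.re : ℂ) - C.re)
    (by simpa using hAC) (by simpa using hBC)).1.mul_const
    (Complex.Gamma A.re * Complex.Gamma (-(B.re : ℂ)))).re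
  refine h.congr (Eventually.of_forall fun R => ?_)
  simp only
  rw [← integral_coreIntegrand_fiber (C.re : ℂ) hA' hB']
  simp_rw [← norm_coreIntegrand]
  rw [integral_complex_ofReal]
  simp

theorem integral_coreIntegrand {A B C : ℂ} (hA : 0 < A.re) (hB : 0 < (-B).re)
    (hAC : 0 < (A + C).re) (hBC : 0 < (-B - C).re) :
    ∫ T, coreIntegrand A B C T = Complex.Gamma A * Complex.Gamma (-B) * Complex.Gamma (A + C)
      * Complex.Gamma (-B - C) / Complex.Gamma (A - B) := by
  have h := integrable_coreIntegrand hA hB hAC hBC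
  rw [Measure.volume_eq_prod] at h ⊢
  rw [integral_prod _ h]
  simp_rw [integral_coreIntegrand_fiber C hA hB]
  rw [integral_mul_const, (integrable_and_integral_beta hAC hBC).2,
    show A + C + (-B - C) = A - B by ring]
  ring

theorem coreIntegrand_sub (A B C : ℂ) (ξ : ℝ) (T : ℝ × ℝ × ℝ) :
    coreIntegrand A B C (T - (ξ, ξ, ξ)) * Complex.exp ((A + B + C) * ξ)
      = Complex.exp (A * T.2.1 + B * T.2.2 + C * T.1 - (Real.exp (T.2.1 - ξ) : ℝ)
        - (Real.exp (ξ - T.2.2) : ℝ) - (Real.exp (T.2.1 - T.1) : ℝ)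
        - (Real.exp (T.1 - T.2.2) : ℝ)) := by
  unfold coreIntegrand
  rw [← Complex.exp_add]
  simp only [Prod.fst_sub, Prod.snd_sub, sub_sub_sub_cancel_right, neg_sub]
  push_cast
  ring_nf

/-! ### Fubini for the five-variable integrand -/

/-- The five-variable integrand obtained from the Givental integrand by writing the factors that
contain `x₁` and `x₃` as Mellin–Barnes integrals over `w`. -/
noncomputable def mixedIntegrand (γ : Fin 3 → ℂ) (x : Fin 3 → ℝ) (T : ℝ × ℝ × ℝ) (w : ℝ × ℝ) : ℂ :=
  (Complex.Gamma (1 + Complex.I * γ 2 - Complex.I * w.1)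
      * Complex.exp (-(1 + Complex.I * γ 2 - Complex.I * w.1) * (x 0 - T.2.1 : ℝ)))
    * (Complex.Gamma (1 + Complex.I * (γ 0 + γ 1) - Complex.I * w.2)
      * Complex.exp (-(1 + Complex.I * (γ 0 + γ 1) - Complex.I * w.2) * (T.2.2 - x 2 : ℝ)))
    * (Complex.exp (Complex.I * (γ 1 - γ 2) * ((T.2.1 : ℂ) + (T.2.2 : ℂ))
        + Complex.I * (γ 0 - γ 1) * (T.1 : ℂ))
      * (Real.exp (-Real.exp (T.2.1 - x 1) - Real.exp (x 1 - T.2.2) - Real.exp (T.2.1 - T.1)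
        - Real.exp (T.1 - T.2.2)) : ℝ))

/-- The integral of `mixedIntegrand` over the Givental variables. -/
noncomputable def barnesKernel (γ : Fin 3 → ℂ) (x : Fin 3 → ℝ) (w : ℝ × ℝ) : ℂ :=
  Complex.exp (-(1 + Complex.I * γ 2 - Complex.I * w.1) * x 0
      + ((1 + Complex.I * γ 1 - Complex.I * w.1)
        + -(1 + Complex.I * (γ 0 + γ 2) - Complex.I * w.2) + Complex.I * (γ 0 - γ 1)) * x 1
      + (1 + Complex.I * (γ 0 + γ 1) - Complex.I * w.2) * x 2)
    * (Complex.Gamma (1 + Complex.I * γ 0 - Complex.I * w.1)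
      * Complex.Gamma (1 + Complex.I * γ 1 - Complex.I * w.1)
      * Complex.Gamma (1 + Complex.I * γ 2 - Complex.I * w.1)
      * Complex.Gamma (1 + Complex.I * (γ 0 + γ 1) - Complex.I * w.2)
      * Complex.Gamma (1 + Complex.I * (γ 0 + γ 2) - Complex.I * w.2)
      * Complex.Gamma (1 + Complex.I * (γ 1 + γ 2) - Complex.I * w.2)
      / Complex.Gamma (2 + Complex.I * (γ 0 + γ 1 + γ 2) - Complex.I * w.1 - Complex.I * w.2))

/-- The Mellin lines through `1 + iγ 2` and `1 + i(γ 0 + γ 1)` are chosen so that the exponents of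
`T₂₁` and `T₂₂` combine into shifts of `1 + iγ 1` and `-(1 + i(γ 0 + γ 2))`. This leads to the Gamma
arguments of `barnesKernel`, symmetric in the `γ i`. -/
theorem mixedIntegrand_eq (γ : Fin 3 → ℂ) (x : Fin 3 → ℝ) (T : ℝ × ℝ × ℝ) (w : ℝ × ℝ) :
    mixedIntegrand γ x T w
      = coreIntegrand (1 + Complex.I * γ 1 - Complex.I * w.1)
          (-(1 + Complex.I * (γ 0 + γ 2) - Complex.I * w.2)) (Complex.I * (γ 0 - γ 1))
          (T - (x 1, x 1, x 1))
        * (Complex.exp (-(1 + Complex.I * γ 2 - Complex.I * w.1) * x 0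
          + ((1 + Complex.I * γ 1 - Complex.I * w.1)
            + -(1 + Complex.I * (γ 0 + γ 2) - Complex.I * w.2) + Complex.I * (γ 0 - γ 1)) * x 1
          + (1 + Complex.I * (γ 0 + γ 1) - Complex.I * w.2) * x 2)
          * (Complex.Gamma (1 + Complex.I * γ 2 - Complex.I * w.1)
            * Complex.Gamma (1 + Complex.I * (γ 0 + γ 1) - Complex.I * w.2))) := by
  have h := coreIntegrand_sub (1 + Complex.I * γ 1 - Complex.I * w.1)
    (-(1 + Complex.I * (γ 0 + γ 2) - Complex.I * w.2)) (Complex.I * (γ 0 - γ 1)) (x 1) T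
  rw [Complex.exp_add, Complex.exp_add]
  unfold mixedIntegrand
  calc _ = (Complex.exp (-(1 + Complex.I * γ 2 - Complex.I * w.1) * x 0)
          * Complex.exp ((1 + Complex.I * (γ 0 + γ 1) - Complex.I * w.2) * x 2))
          * (Complex.Gamma (1 + Complex.I * γ 2 - Complex.I * w.1)
            * Complex.Gamma (1 + Complex.I * (γ 0 + γ 1) - Complex.I * w.2))
          * Complex.exp ((1 + Complex.I * γ 1 - Complex.I * w.1) * T.2.1
            + -(1 + Complex.I * (γ 0 + γ 2) - Complex.I * w.2) * T.2.2
            + Complex.I * (γ 0 - γ 1) * T.1 - (Real.exp (T.2.1 - x 1) : ℝ)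
            - (Real.exp (x 1 - T.2.2) : ℝ) - (Real.exp (T.2.1 - T.1) : ℝ)
            - (Real.exp (T.1 - T.2.2) : ℝ)) := by
        rw [mul_mul_mul_comm (Complex.Gamma _), mul_comm (Complex.Gamma _ * Complex.Gamma _),
          mul_right_comm, mul_right_comm _ (Complex.Gamma _ * Complex.Gamma _)]
        congr 1
        rw [Complex.ofReal_exp, ← Complex.exp_add, ← Complex.exp_add, ← Complex.exp_add,
          ← Complex.exp_add, ← Complex.exp_add]
        congr 1
        push_cast
        ring
    _ = _ := by
        rw [← h]
        ring

theorem coreIntegrand_sub_I_mul (A B C : ℂ) (s t : ℝ) (T : ℝ × ℝ × ℝ) :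
    coreIntegrand (A - Complex.I * s) (B + Complex.I * t) C T
      = coreIntegrand A B C T * Complex.exp (-(Complex.I * s * T.2.1) + Complex.I * t * T.2.2) := by
  unfold coreIntegrand
  rw [← Complex.exp_add]
  ring_nf

theorem isAddRightInvariant_volume_real_prod₃ :
    (volume : Measure (ℝ × ℝ × ℝ)).IsAddRightInvariant := by
  have : (volume : Measure (ℝ × ℝ)).IsAddRightInvariant :=
    inferInstanceAs (((volume : Measure ℝ).prod volume).IsAddRightInvariant)
  exact inferInstanceAs (((volume : Measure ℝ).prod
    (volume : Measure (ℝ × ℝ))).IsAddRightInvariant)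

theorem re_one_add_I_mul_pos {γ : Fin 3 → ℂ} (hγ : ∀ i, (γ i).im < 1 / 2) (i : Fin 3) :
    0 < (1 + Complex.I * γ i).re := by
  have := hγ i
  simp
  linarith

theorem re_one_add_I_mul_add_pos {γ : Fin 3 → ℂ} (hγ : ∀ i, (γ i).im < 1 / 2) (i j : Fin 3) :
    0 < (1 + Complex.I * (γ i + γ j)).re := by
  have := hγ i
  have := hγ j
  simp
  linarith

/-- The variable `w` enters the core integrand only through a phase. The whole is thus a product of
integrable functions of separate variables and a factor `E` of constant modulus. -/
theorem integrable_mixedIntegrand {γ : Fin 3 → ℂ} (hγ : ∀ i, (γ i).im < 1 / 2) (x : Fin 3 → ℝ) :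
    Integrable (Function.uncurry (mixedIntegrand γ x)) (volume.prod volume) := by
  have p := re_one_add_I_mul_pos hγ
  have q := re_one_add_I_mul_add_pos hγ
  have hcore : Integrable (coreIntegrand (1 + Complex.I * γ 1) (-(1 + Complex.I * (γ 0 + γ 2)))
      (Complex.I * (γ 0 - γ 1))) := by
    refine integrable_coreIntegrand (p 1) (by simpa using q 0 2) ?_ ?_
    · convert p 0 using 2; ring
    · convert q 1 2 using 2; ring
  have := isAddRightInvariant_volume_real_prod₃
  have h := (hcore.comp_sub_right (x 1, x 1, x 1)).mul_prod
    ((integrable_Gamma_vertical (p 2)).mul_prod (integrable_Gamma_vertical (q 0 1)))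
  set E : (ℝ × ℝ × ℝ) × (ℝ × ℝ) → ℂ := fun P => Complex.exp
    (-(Complex.I * P.2.1 * (P.1.2.1 - x 1 : ℝ)) + Complex.I * P.2.2 * (P.1.2.2 - x 1 : ℝ)
      + (-(1 + Complex.I * γ 2 - Complex.I * P.2.1) * x 0
          + ((1 + Complex.I * γ 1 - Complex.I * P.2.1)
            + -(1 + Complex.I * (γ 0 + γ 2) - Complex.I * P.2.2) + Complex.I * (γ 0 - γ 1)) * x 1
          + (1 + Complex.I * (γ 0 + γ 1) - Complex.I * P.2.2) * x 2)) with hE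
  have hEn : ∀ P, ‖E P‖ ≤ ‖E 0‖ := by
    intro P
    refine le_of_eq ?_
    simp only [hE, Complex.norm_exp]
    congr 1
    simp
  refine (h.mul_bdd (g := E) (Continuous.aestronglyMeasurable (by fun_prop))
    (Eventually.of_forall hEn)).congr (Eventually.of_forall fun P => ?_)
  simp only [Function.uncurry_def, mixedIntegrand_eq, hE]
  rw [Complex.exp_add, show -(1 + Complex.I * (γ 0 + γ 2) - Complex.I * (P.2.2 : ℂ))
      = -(1 + Complex.I * (γ 0 + γ 2)) + Complex.I * P.2.2 by ring, coreIntegrand_sub_I_mul]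
  simp only [Prod.snd_sub, Prod.fst_sub]
  ring_nf

theorem integral_mixedIntegrand_right {γ : Fin 3 → ℂ} (hγ : ∀ i, (γ i).im < 1 / 2)
    (x : Fin 3 → ℝ) (T : ℝ × ℝ × ℝ) :
    ∫ w, mixedIntegrand γ x T w = (2 * Real.pi) ^ 2 * giventalIntegrand γ x T := by
  obtain ⟨T₁, T₂, T₃⟩ := T
  unfold mixedIntegrand
  rw [integral_mul_const, Measure.volume_eq_prod]
  rw [integral_prod_mul
    (fun τ : ℝ => Complex.Gamma (1 + Complex.I * γ 2 - Complex.I * τ)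
      * Complex.exp (-(1 + Complex.I * γ 2 - Complex.I * τ) * (x 0 - T₂ : ℝ)))
    (fun σ : ℝ => Complex.Gamma (1 + Complex.I * (γ 0 + γ 1) - Complex.I * σ)
      * Complex.exp (-(1 + Complex.I * (γ 0 + γ 1) - Complex.I * σ) * (T₃ - x 2 : ℝ))),
    integral_Gamma_mul_exp (re_one_add_I_mul_pos hγ 2),
    integral_Gamma_mul_exp (re_one_add_I_mul_add_pos hγ 0 1)]
  simp only [giventalIntegrand]
  have e : -Real.exp (x 0 - T₂) - Real.exp (T₂ - x 1) - Real.exp (x 1 - T₃) - Real.exp (T₃ - x 2)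
      - Real.exp (T₂ - T₁) - Real.exp (T₁ - T₃)
      = -Real.exp (x 0 - T₂) + -Real.exp (T₃ - x 2) + (-Real.exp (T₂ - x 1) - Real.exp (x 1 - T₃)
      - Real.exp (T₂ - T₁) - Real.exp (T₁ - T₃)) := by ring
  rw [e, Real.exp_add, Real.exp_add, Complex.ofReal_mul, Complex.ofReal_mul]
  ring

theorem integral_mixedIntegrand_left {γ : Fin 3 → ℂ} (hγ : ∀ i, (γ i).im < 1 / 2)
    (x : Fin 3 → ℝ) (w : ℝ × ℝ) :
    ∫ T, mixedIntegrand γ x T w = barnesKernel γ x w := by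
  have p := fun i => re_one_add_I_mul_pos hγ i
  have q := fun i j => re_one_add_I_mul_add_pos hγ i j
  have := isAddRightInvariant_volume_real_prod₃
  simp_rw [mixedIntegrand_eq]
  rw [integral_mul_const, integral_sub_right_eq_self (fun T => coreIntegrand _ _ _ T),
    integral_coreIntegrand (by simpa using p 1) (by simpa using q 0 2)
      (by convert p 0 using 1; simp; ring) (by convert q 1 2 using 1; simp; ring)]
  unfold barnesKernel
  rw [neg_neg, show 1 + Complex.I * γ 1 - Complex.I * w.1 + Complex.I * (γ 0 - γ 1)
      = 1 + Complex.I * γ 0 - Complex.I * w.1 by ring,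
    show 1 + Complex.I * (γ 0 + γ 2) - Complex.I * w.2 - Complex.I * (γ 0 - γ 1)
      = 1 + Complex.I * (γ 1 + γ 2) - Complex.I * w.2 by ring,
    show 1 + Complex.I * γ 1 - Complex.I * w.1 - -(1 + Complex.I * (γ 0 + γ 2) - Complex.I * w.2)
      = 2 + Complex.I * (γ 0 + γ 1 + γ 2) - Complex.I * w.1 - Complex.I * w.2 by ring]
  ring

/-- Up to the factor `(2π)²`, the integrand is a marginal of an integrable function. -/
theorem integrable_giventalIntegrand {γ : Fin 3 → ℂ} (hγ : ∀ i, (γ i).im < 1 / 2)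
    (x : Fin 3 → ℝ) : Integrable (giventalIntegrand γ x) := by
  have h := (integrable_mixedIntegrand hγ x).integral_prod_left
  simp only [Function.uncurry_apply_pair, integral_mixedIntegrand_right hγ x] at h
  have hpi : ((2 * Real.pi : ℂ)) ^ 2 ≠ 0 := by
    simp [Real.pi_ne_zero]
  exact (integrable_const_mul_iff (IsUnit.mk0 _ hpi) _).1 h

theorem integral_giventalIntegrand {γ : Fin 3 → ℂ} (hγ : ∀ i, (γ i).im < 1 / 2)
    (x : Fin 3 → ℝ) :
    (2 * Real.pi) ^ 2 * ∫ T, giventalIntegrand γ x T = ∫ w, barnesKernel γ x w := by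
  have h := integral_integral_swap (integrable_mixedIntegrand hγ x)
  simp_rw [integral_mixedIntegrand_right hγ x, integral_mixedIntegrand_left hγ x] at h
  rw [← h, integral_const_mul]

/-! ### The Mellin–Barnes integrand: density and integrability -/

theorem one_div_Gamma_mul_Gamma_neg (t : ℝ) :
    1 / (Complex.Gamma (Complex.I * (2 * t)) * Complex.Gamma (-(Complex.I * (2 * t))))
      = wilsonDensity t := by
  have hpi : (Real.pi : ℂ) ≠ 0 := by exact_mod_cast Real.pi_ne_zero
  -- At `t = 0` the left side is `0` by the conventions `Complex.Gamma 0 = 0` and `1 / 0 = 0`;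
  -- elsewhere the reflection formula applies.
  rcases eq_or_ne t 0 with rfl | ht
  · simp [wilsonDensity]
  set z : ℂ := Complex.I * (2 * t) with hz
  have hz0 : -z ≠ 0 := by
    simp [hz, ht]
  have h := Complex.Gamma_mul_Gamma_one_sub z
  rw [sub_eq_neg_add, Complex.Gamma_add_one _ hz0] at h
  have h1 : Complex.Gamma z * Complex.Gamma (-z) = Real.pi / (-z * Complex.sin (Real.pi * z)) := by
    rw [mul_comm (-z), ← div_div, ← h, eq_div_iff hz0]
    ring
  rw [h1, one_div_div, hz, show (Real.pi : ℂ) * (Complex.I * (2 * t))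
    = ((2 * Real.pi * t : ℝ) : ℂ) * Complex.I by push_cast; ring, Complex.sin_mul_I]
  unfold wilsonDensity
  push_cast
  linear_combination (-(2 * t * Complex.sinh (2 * Real.pi * t) / Real.pi)) * Complex.I_sq

theorem mellinBarnesIntegrand_eq (γ : Fin 3 → ℂ) (x : Fin 3 → ℝ) (τ : ℝ × ℝ × ℝ) :
    mellinBarnesIntegrand γ x τ
      = (wilsonDensity ((τ.2.1 - τ.2.2) / 2) : ℂ)
        * Complex.exp (Complex.I * ((x 1 : ℂ) - (x 2 : ℂ)) * ((τ.2.1 : ℂ) + (τ.2.2 : ℂ))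
          + Complex.I * ((x 0 : ℂ) - (x 1 : ℂ)) * (τ.1 : ℂ))
        * Complex.Gamma (Complex.I * ((τ.2.1 : ℂ) - (τ.1 : ℂ)) + 1 / 2)
        * Complex.Gamma (Complex.I * ((τ.2.2 : ℂ) - (τ.1 : ℂ)) + 1 / 2)
        * ((Complex.Gamma (Complex.I * (γ 0 - (τ.2.1 : ℂ)) + 1 / 2)
            * Complex.Gamma (Complex.I * (γ 0 - (τ.2.2 : ℂ)) + 1 / 2))
          * (Complex.Gamma (Complex.I * (γ 1 - (τ.2.1 : ℂ)) + 1 / 2)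
            * Complex.Gamma (Complex.I * (γ 1 - (τ.2.2 : ℂ)) + 1 / 2))
          * (Complex.Gamma (Complex.I * (γ 2 - (τ.2.1 : ℂ)) + 1 / 2)
            * Complex.Gamma (Complex.I * (γ 2 - (τ.2.2 : ℂ)) + 1 / 2))) := by
  obtain ⟨τ₁, τ₂, τ₃⟩ := τ
  simp only [mellinBarnesIntegrand, Fin.prod_univ_three]
  rw [← one_div_Gamma_mul_Gamma_neg,
    show Complex.I * (2 * (((τ₂ - τ₃) / 2 : ℝ) : ℂ)) = Complex.I * τ₂ - Complex.I * τ₃ by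
      push_cast; ring, neg_sub]

theorem re_I_mul_sub_add_half {g : ℂ} (hg : g.im < 1 / 2) (t : ℝ) :
    0 < (Complex.I * (g - t) + 1 / 2).re := by
  simp
  linarith

theorem exists_norm_Gamma_I_mul_sub_le {g : ℂ} (hg : g.im < 1 / 2) :
    ∃ C, 0 ≤ C ∧ ∀ t : ℝ,
      ‖Complex.Gamma (Complex.I * (g - t) + 1 / 2)‖ ≤ C * Real.exp (-(3 / 2) * |t|) := by
  have hre : ∀ t : ℝ, (Complex.I * (g - t) + 1 / 2).re = 1 / 2 - g.im := fun t => by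
    simp; ring
  have hC := gammaBound_nonneg (σ := 1 / 2 - g.im) (by linarith)
  refine ⟨gammaBound (1 / 2 - g.im) * Real.exp (3 / 2 * |g.re|), by positivity, fun t => ?_⟩
  refine (norm_Gamma_le (re_I_mul_sub_add_half hg t)).trans ?_
  rw [hre, mul_assoc, ← Real.exp_add]
  refine mul_le_mul_of_nonneg_left (Real.exp_le_exp.2 ?_) hC
  have : (Complex.I * (g - t) + 1 / 2).im = g.re - t := by simp
  rw [this]
  have := abs_sub_abs_le_abs_sub t g.re
  rw [abs_sub_comm] at this
  linarith

theorem continuous_mellinBarnesIntegrand {γ : Fin 3 → ℂ} (hγ : ∀ i, (γ i).im < 1 / 2)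
    (x : Fin 3 → ℝ) : Continuous (mellinBarnesIntegrand γ x) := by
  have h0 := hγ 0
  have h1 := hγ 1
  have h2 := hγ 2
  rw [show mellinBarnesIntegrand γ x = _ from funext (mellinBarnesIntegrand_eq γ x)]
  refine ((Continuous.mul (Continuous.mul ?_ (by fun_prop)) ?_).mul ?_).mul
    (((Continuous.mul ?_ ?_).mul (Continuous.mul ?_ ?_)).mul (Continuous.mul ?_ ?_))
  · exact Complex.continuous_ofReal.comp (continuous_wilsonDensity.comp (by fun_prop))
  all_goals
    refine continuous_Gamma_comp (by fun_prop) fun τ => ?_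
    simp
    try linarith

/-- The density grows at most like `e^(4|u| + 4|v|)`, and the six factors with `γ` decay like
`e^(-9/2 (|u| + |v|))`. One of the two Gamma factors with `t` supplies decay in `|t - u|`; the other
need only be bounded. Using `|t| ≤ |t - u| + |u|`, rate `1/4` is left in each variable. -/
theorem integrable_mellinBarnesIntegrand {γ : Fin 3 → ℂ} (hγ : ∀ i, (γ i).im < 1 / 2)
    (x : Fin 3 → ℝ) : Integrable (mellinBarnesIntegrand γ x) := by
  obtain ⟨A, hA, hA'⟩ := exists_norm_Gamma_I_mul_sub_le (hγ 0)
  obtain ⟨B, hB, hB'⟩ := exists_norm_Gamma_I_mul_sub_le (hγ 1)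
  obtain ⟨C, hC, hC'⟩ := exists_norm_Gamma_I_mul_sub_le (hγ 2)
  obtain ⟨D, hD, hD'⟩ := exists_norm_Gamma_I_mul_sub_le (g := 0) (by norm_num)
  have hshift : ∀ s t : ℝ, ‖Complex.Gamma (Complex.I * ((s : ℂ) - (t : ℂ)) + 1 / 2)‖
      ≤ D * Real.exp (-(3 / 2) * |t - s|) := by
    intro s t
    have := hD' (t - s)
    convert this using 4
    push_cast
    ring
  have he := integrable_exp_neg_mul_abs (c := 1 / 4) (by norm_num)
  set K : ℝ := 8 * D * D * (A * A * (B * B) * (C * C)) with hK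
  refine ((he.mul_prod (he.mul_prod he)).const_mul K).mono'
    (continuous_mellinBarnesIntegrand hγ x).aestronglyMeasurable (Eventually.of_forall fun τ => ?_)
  obtain ⟨t, u, v⟩ := τ
  rw [mellinBarnesIntegrand_eq]
  simp only [norm_mul]
  have hexp : ‖Complex.exp (Complex.I * ((x 1 : ℂ) - (x 2 : ℂ)) * ((u : ℂ) + (v : ℂ))
      + Complex.I * ((x 0 : ℂ) - (x 1 : ℂ)) * (t : ℂ))‖ = 1 := by
    rw [Complex.norm_exp]; simp
  have hdens := norm_wilsonDensity_le ((u - v) / 2)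
  have hfar : ‖Complex.Gamma (Complex.I * ((v : ℂ) - (t : ℂ)) + 1 / 2)‖ ≤ D := by
    refine (hshift v t).trans (mul_le_of_le_one_right hD (Real.exp_le_one_iff.2 ?_))
    nlinarith [abs_nonneg (t - v)]
  rw [hexp, mul_one]
  calc _ ≤ 8 * Real.exp (8 * |(u - v) / 2|) * (D * Real.exp (-(3 / 2) * |t - u|)) * D
        * ((A * Real.exp (-(3 / 2) * |u|) * (A * Real.exp (-(3 / 2) * |v|)))
          * (B * Real.exp (-(3 / 2) * |u|) * (B * Real.exp (-(3 / 2) * |v|)))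
          * (C * Real.exp (-(3 / 2) * |u|) * (C * Real.exp (-(3 / 2) * |v|)))) := by
        gcongr
        · exact hshift u t
        · exact hA' u
        · exact hA' v
        · exact hB' u
        · exact hB' v
        · exact hC' u
        · exact hC' v
    _ = K * (Real.exp (8 * |(u - v) / 2|) * Real.exp (-(3 / 2) * |t - u|)
        * (Real.exp (-(3 / 2) * |u|) ^ 3 * Real.exp (-(3 / 2) * |v|) ^ 3)) := by
        rw [hK]; ring
    _ ≤ K * (Real.exp (-(1 / 4 * |t|)) * (Real.exp (-(1 / 4 * |u|)) * Real.exp (-(1 / 4 * |v|)))) := by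
        refine mul_le_mul_of_nonneg_left ?_ (by positivity)
        rw [← Real.exp_nat_mul, ← Real.exp_nat_mul]
        simp only [← Real.exp_add]
        refine Real.exp_le_exp.2 ?_
        rw [abs_div, abs_two]
        have a1 := abs_sub u v
        have a2 := abs_sub_abs_le_abs_sub t u
        have a3 := abs_nonneg (t - u)
        have a4 := abs_nonneg v
        push_cast
        linarith

/-! ### Change of variables and comparison of the two sides -/

/-- The change of variables `τ₂₁ = σ / 2 + t`, `τ₂₂ = σ / 2 - t`. -/
theorem measurePreserving_half_add_half_sub :
    MeasurePreserving (fun p : ℝ × ℝ => (p.1 / 2 + p.2, p.1 / 2 - p.2))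
      (volume.prod volume) (volume.prod volume) := by
  -- The map is the composite `(σ, t) ↦ (σ, t + σ/2) ↦ (t + σ/2, σ) ↦ (t + σ/2, σ/2 - t)` of shears
  -- and a swap.
  have h1 : MeasurePreserving (fun p : ℝ × ℝ => (p.1, p.2 + p.1 / 2))
      (volume.prod volume) (volume.prod volume) :=
    (MeasurePreserving.id volume).skew_product (g := fun σ t => t + σ / 2) (by fun_prop)
      (Eventually.of_forall fun σ => (measurePreserving_add_right volume (σ / 2)).map_eq)
  have h2 := (measurePreserving_prod_sub (volume : Measure ℝ) (volume : Measure ℝ)).comp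
    (Measure.measurePreserving_swap.comp h1)
  convert h2 using 1
  ext p
  · simp [add_comm]
  · simp
    ring

theorem measurableEmbedding_half_add_half_sub :
    MeasurableEmbedding fun P : (ℝ × ℝ) × ℝ => (P.1.1, P.1.2 / 2 + P.2, P.1.2 / 2 - P.2) := by
  refine (Homeomorph.mk (Equiv.mk
    (fun P : (ℝ × ℝ) × ℝ => (P.1.1, P.1.2 / 2 + P.2, P.1.2 / 2 - P.2))
    (fun τ : ℝ × ℝ × ℝ => ((τ.1, τ.2.1 + τ.2.2), (τ.2.1 - τ.2.2) / 2))
    (fun p => ?_) (fun p => ?_)) ?_ ?_).measurableEmbedding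
  · ext <;> simp
  · ext <;> simp <;> ring
  · fun_prop
  · fun_prop

theorem measurePreserving_prod_half_add_half_sub :
    MeasurePreserving (fun P : (ℝ × ℝ) × ℝ => (P.1.1, P.1.2 / 2 + P.2, P.1.2 / 2 - P.2))
      (((volume : Measure ℝ).prod volume).prod volume) volume :=
  ((MeasurePreserving.id volume).prod measurePreserving_half_add_half_sub).comp
    (measurePreserving_prodAssoc volume volume volume)

/-- The eight numerator Gamma factors pair up as `gammaPair`s of `a` and the `b i`. In the sums `a +
b i` the variable `σ = w.2` cancels, and in `b i + b j` no `τ₁₁` occurs, which yields the arguments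
of `barnesKernel`. -/
theorem integral_mellinBarnesIntegrand_fiber {γ : Fin 3 → ℂ} (hγ : ∀ i, (γ i).im < 1 / 2)
    (x : Fin 3 → ℝ) (w : ℝ × ℝ) :
    Complex.exp (Complex.I * (γ 0 + γ 1 + γ 2) * (x 2 : ℂ) - ((x 0 : ℂ) - (x 2 : ℂ)))
      * ∫ t : ℝ, mellinBarnesIntegrand γ x (w.1, w.2 / 2 + t, w.2 / 2 - t)
      = 4 * Real.pi * (Complex.exp (Complex.I * γ 2 * ((x 0 : ℂ) + (x 1 : ℂ) + (x 2 : ℂ)))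
        * barnesKernel γ x w) := by
  set a : ℂ := 1 / 2 + Complex.I * (w.2 / 2 - w.1) with ha
  set b : Fin 3 → ℂ := fun i => 1 / 2 + Complex.I * (γ i - w.2 / 2) with hb
  have ha' : 0 < a.re := by simp [ha]
  have hb' : ∀ i, 0 < (b i).re := by
    intro i
    have := hγ i
    simp [hb]
    linarith
  have hfib : ∫ t : ℝ, mellinBarnesIntegrand γ x (w.1, w.2 / 2 + t, w.2 / 2 - t)
      = Complex.exp (Complex.I * ((x 1 : ℂ) - (x 2 : ℂ)) * w.2
          + Complex.I * ((x 0 : ℂ) - (x 1 : ℂ)) * w.1) * wilsonIntegral a (b 0) (b 1) (b 2) := by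
    unfold wilsonIntegral
    rw [← integral_const_mul]
    refine integral_congr_ae (Eventually.of_forall fun t => ?_)
    simp only [mellinBarnesIntegrand_eq, gammaPair, ha, hb]
    push_cast
    ring_nf
  rw [hfib, wilsonIntegral_eq ha' (hb' 0) (hb' 1) (hb' 2)]
  have e1 : ∀ i, a + b i = 1 + Complex.I * γ i - Complex.I * w.1 := fun i => by
    simp only [ha, hb]; ring
  have e2 : ∀ i j, b i + b j = 1 + Complex.I * (γ i + γ j) - Complex.I * w.2 := fun i j => by
    simp only [hb]; ring
  have e3 : a + b 0 + b 1 + b 2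
      = 2 + Complex.I * (γ 0 + γ 1 + γ 2) - Complex.I * w.1 - Complex.I * w.2 := by
    simp only [ha, hb]; ring
  rw [e3, e1, e1, e1, e2, e2, e2]
  unfold barnesKernel
  have hexp : Complex.exp (Complex.I * (γ 0 + γ 1 + γ 2) * (x 2 : ℂ) - ((x 0 : ℂ) - (x 2 : ℂ)))
      * Complex.exp (Complex.I * ((x 1 : ℂ) - (x 2 : ℂ)) * w.2
        + Complex.I * ((x 0 : ℂ) - (x 1 : ℂ)) * w.1)
      = Complex.exp (Complex.I * γ 2 * ((x 0 : ℂ) + (x 1 : ℂ) + (x 2 : ℂ)))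
        * Complex.exp (-(1 + Complex.I * γ 2 - Complex.I * w.1) * x 0
          + ((1 + Complex.I * γ 1 - Complex.I * w.1)
            + -(1 + Complex.I * (γ 0 + γ 2) - Complex.I * w.2) + Complex.I * (γ 0 - γ 1)) * x 1
          + (1 + Complex.I * (γ 0 + γ 1) - Complex.I * w.2) * x 2) := by
    rw [← Complex.exp_add, ← Complex.exp_add]
    ring_nf
  rw [← mul_assoc, hexp]
  ring

theorem mainTheorem2 (γ : Fin 3 → ℂ) (hγ : ∀ i, (γ i).im < 1 / 2) (x : Fin 3 → ℝ) :
    MeasureTheory.Integrable (giventalIntegrand γ x) ∧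
    MeasureTheory.Integrable (mellinBarnesIntegrand γ x) ∧
    giventalIntegral γ x = mellinBarnesIntegral γ x := by
  refine ⟨integrable_giventalIntegrand hγ x, integrable_mellinBarnesIntegrand hγ x, ?_⟩
  have hpi : (Real.pi : ℂ) ≠ 0 := by exact_mod_cast Real.pi_ne_zero
  have hmp := measurePreserving_prod_half_add_half_sub
  have hme := measurableEmbedding_half_add_half_sub
  have hint : Integrable (fun P : (ℝ × ℝ) × ℝ =>
      mellinBarnesIntegrand γ x (P.1.1, P.1.2 / 2 + P.2, P.1.2 / 2 - P.2))
      (((volume : Measure ℝ).prod volume).prod volume) :=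
    (hmp.integrable_comp_emb hme).2 (integrable_mellinBarnesIntegrand hγ x)
  have hI : ∫ τ, mellinBarnesIntegrand γ x τ = ∫ w : ℝ × ℝ, ∫ t : ℝ,
      mellinBarnesIntegrand γ x (w.1, w.2 / 2 + t, w.2 / 2 - t) :=
    (hmp.integral_comp hme (mellinBarnesIntegrand γ x)).symm.trans (integral_prod _ hint)
  have hG := integral_giventalIntegrand hγ x
  unfold giventalIntegral mellinBarnesIntegral
  rw [hI, div_mul_eq_mul_div, ← integral_const_mul (Complex.exp _) fun w : ℝ × ℝ =>
    ∫ t : ℝ, mellinBarnesIntegrand γ x (w.1, w.2 / 2 + t, w.2 / 2 - t)]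
  simp only [integral_mellinBarnesIntegrand_fiber hγ x]
  -- The constants match: `4π (2π)² = 2 (2π)³`.
  rw [integral_const_mul, integral_const_mul, ← hG]
  field_simp
  ring
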